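/- Let $r\ge t\ge 2$ be integers. All hypergraphs are finite. A Steiner $(r,t)$-system is a finite $r$-uniform hypergraph $G=(V(G),E(G))$ (every edge is an $r$-element subset of $V(G)$) such that every $t$-element subset of $V(G)$ is contained in at most one edge. An ordered Steiner $(r,t)$-system is one together with a linear ordering of its vertex set. Isomorphisms are bijections of the vertex sets preserving edges and non-edges and, in the ordered case, the orderings. $G$ is an induced subsystem of $H$ if $V(G)\subseteq V(H)$ and $E(G)=\{e\in E(H): e\subseteq V(G)\}$ (and, in the ordered case, the ordering of $G$ is the restriction of that of $H$); it is strongly induced if moreover $|e\cap V(G)|<t$ for all $e\in E(H)\setminus E(G)$. This gives four classes: the objects are all unordered, respectively all ordered, Steiner $(r,t)$-systems, and the subobjects are the induced subsystems (weak classes) or the strongly induced subsystems (strong classes). For objects $F,G$ of such a class $\mathscr T$, let $\binom{G}{F}$ be the set of subobjects of $G$ isomorphic to $F$. The class $\mathscr T$ has the $F$-Ramsey property if for every $G\in\mathscr T$ and every integer $c\ge1$ there is $H\in\mathscr T$ such that for every colouring of $\binom HF$ with $c$ colours there is $\widetilde G\in\binom HG$ such that all members of $\binom{\widetilde G}{F}$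 have the same colour. A Steiner system $F$ is homogeneous if every permutation of $V(F)$ is an automorphism of the underlying hypergraph, and complete if every $t$-element subset of $V(F)$ is contained in an edge of $F$. **Theorem.** Let $\mathscr T$ be any of the four classes and let $F\in\mathscr T$. Then $\mathscr T$ has the $F$-Ramsey property if and only if both of the following conditions hold: (i) if $\mathscr T$ is unordered, then $F$ is homogeneous; (ii) if $\mathscr T$ is weak and $t<r$, then $F$ is complete. -/

import Mathlib

universe u

/-- A class of objects endowed with an equivalence relation (isomorphism) and a transitive
subobject relation. -/
structure ObjectClass where
  Obj : Type u
  Iso : Obj → Obj → Prop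
  iso_equiv : Equivalence Iso
  Sub : Obj → Obj → Prop
  sub_trans : ∀ {A B C : Obj}, Sub A B → Sub B C → Sub A C

namespace ObjectClass

/-- `C.copies G F` is the class of all subobjects of `G` that are isomorphic to `F`. -/
def copies (C : ObjectClass.{u}) (G F : C.Obj) : Set C.Obj :=
  {A | C.Sub A G ∧ C.Iso A F}

theorem copies_subset (C : ObjectClass.{u}) {H G' F : C.Obj} (h : C.Sub G' H) :
    C.copies G' F ⊆ C.copies H F :=
  fun _ hA => ⟨C.sub_trans hA.1 h, hA.2⟩

/-- The partition relation `H ⟶ (G)^F_c`: for every colouring of the copies of `F` in `H` with `c`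
colours there is a copy `G'` of `G` in `H` all of whose copies of `F` have the same colour. -/
def Arrows (C : ObjectClass.{u}) (H G F : C.Obj) (c : ℕ) : Prop :=
  ∀ χ : C.copies H F → Fin c,
    ∃ (G' : C.Obj) (hG' : G' ∈ C.copies H G), ∃ i : Fin c,
      ∀ (F' : C.Obj) (hF' : F' ∈ C.copies G' F), χ ⟨F', C.copies_subset hG'.1 hF'⟩ = i

/-- The `F`-Ramsey property of a class. -/
def HasRamseyProperty (C : ObjectClass.{u}) (F : C.Obj) : Prop :=
  ∀ (G : C.Obj) (c : ℕ), 0 < c → ∃ H : C.Obj, C.Arrows H G F c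

end ObjectClass

/-- A (finite, partial) Steiner `(r, t)`-system: an `r`-uniform hypergraph such that every
`t`-element set of vertices is contained in at most one edge. Vertices are taken from `α`. -/
structure SteinerSystem (α : Type u) (r t : ℕ) where
  /-- the vertex set -/
  V : Finset α
  /-- the edge set -/
  E : Set (Finset α)
  edge_subset : ∀ e ∈ E, e ⊆ V
  edge_card : ∀ e ∈ E, e.card = r
  steiner : ∀ x : Finset α, x ⊆ V → x.card = t →
    ∀ e ∈ E, ∀ e' ∈ E, x ⊆ e → x ⊆ e' → e = e'

namespace SteinerSystem

variable {α : Type u} {r t : ℕ}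

/-- A bijection between the vertex sets is a hypergraph isomorphism if it preserves edges and
non-edges. -/
def IsIsomorphism (F G : SteinerSystem α r t) (φ : F.V ≃ G.V) : Prop :=
  ∀ e : Finset F.V, e.map (Function.Embedding.subtype _) ∈ F.E ↔
    (e.map φ.toEmbedding).map (Function.Embedding.subtype _) ∈ G.E

/-- Isomorphism of (unordered) Steiner systems. -/
def Iso (F G : SteinerSystem α r t) : Prop :=
  ∃ φ : F.V ≃ G.V, F.IsIsomorphism G φ

/-- `G` is an induced subsystem of `H`. -/
def Induced (G H : SteinerSystem α r t) : Prop :=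
  G.V ⊆ H.V ∧ ∀ e : Finset α, e ∈ G.E ↔ e ∈ H.E ∧ e ⊆ G.V

/-- `G` is a strongly induced subsystem of `H`. -/
def StronglyInduced [DecidableEq α] (G H : SteinerSystem α r t) : Prop :=
  G.Induced H ∧ ∀ e ∈ H.E, e ∉ G.E → (e ∩ G.V).card < t

/-- Every permutation of the vertex set is an automorphism. -/
def IsHomogeneous (F : SteinerSystem α r t) : Prop :=
  ∀ σ : Equiv.Perm F.V, F.IsIsomorphism F σ

/-- Every `t`-element set of vertices is contained in an edge. -/
def IsComplete (F : SteinerSystem α r t) : Prop :=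
  ∀ x : Finset α, x ⊆ F.V → x.card = t → ∃ e ∈ F.E, x ⊆ e

theorem isIsomorphism_refl (F : SteinerSystem α r t) : F.IsIsomorphism F (Equiv.refl _) := by
  intro e
  simp [Equiv.toEmbedding, Function.Embedding.subtype]

theorem IsIsomorphism.symm {F G : SteinerSystem α r t} {φ : F.V ≃ G.V}
    (h : F.IsIsomorphism G φ) : G.IsIsomorphism F φ.symm := by
  intro e
  rw [h (e.map φ.symm.toEmbedding)]
  have : (e.map φ.symm.toEmbedding).map φ.toEmbedding = e := by
    ext x
    simp
  rw [this]

theorem IsIsomorphism.trans {F G H : SteinerSystem α r t} {φ : F.V ≃ G.V} {ψ : G.V ≃ H.V}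
    (h : F.IsIsomorphism G φ) (h' : G.IsIsomorphism H ψ) :
    F.IsIsomorphism H (φ.trans ψ) := by
  intro e
  have : e.map (φ.trans ψ).toEmbedding = (e.map φ.toEmbedding).map ψ.toEmbedding := by
    rw [Finset.map_map]
    rfl
  rw [this, h e, h' _]

theorem iso_equivalence : Equivalence (Iso : SteinerSystem α r t → SteinerSystem α r t → Prop) :=
  ⟨fun F => ⟨_, F.isIsomorphism_refl⟩, fun ⟨_, h⟩ => ⟨_, h.symm⟩,
    fun ⟨_, h⟩ ⟨_, h'⟩ => ⟨_, h.trans h'⟩⟩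

theorem Induced.trans {A B C : SteinerSystem α r t} (h : A.Induced B) (h' : B.Induced C) :
    A.Induced C := by
  refine ⟨h.1.trans h'.1, fun e => ?_⟩
  rw [h.2 e, h'.2 e]
  exact ⟨fun k => ⟨k.1.1, k.2⟩, fun k => ⟨⟨k.1, k.2.trans h.1⟩, k.2⟩⟩

theorem StronglyInduced.trans [DecidableEq α] {A B C : SteinerSystem α r t}
    (h : A.StronglyInduced B) (h' : B.StronglyInduced C) : A.StronglyInduced C := by
  refine ⟨h.1.trans h'.1, fun e he heA => ?_⟩
  by_cases heB : e ∈ B.E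
  · exact h.2 e heB heA
  · exact (Finset.card_le_card (Finset.inter_subset_inter_left h.1.1)).trans_lt (h'.2 e he heB)

end SteinerSystem

/-- A Steiner system with a fixed linear ordering of its vertex set; `lt x y` means that `x` and
`y` are vertices and that `x` precedes `y`. -/
structure OrderedSteinerSystem (α : Type u) (r t : ℕ) extends SteinerSystem α r t where
  lt : α → α → Prop
  lt_mem : ∀ x y, lt x y → x ∈ V ∧ y ∈ V
  lt_irrefl : ∀ x, ¬ lt x x
  lt_trans : ∀ x y z, lt x y → lt y z → lt x z
  lt_total : ∀ x ∈ V, ∀ y ∈ V, x ≠ y → lt x y ∨ lt y x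

namespace OrderedSteinerSystem

variable {α : Type u} {r t : ℕ}

/-- Isomorphism of ordered Steiner systems: an order preserving hypergraph isomorphism. -/
def Iso (F G : OrderedSteinerSystem α r t) : Prop :=
  ∃ φ : F.V ≃ G.V, F.toSteinerSystem.IsIsomorphism G.toSteinerSystem φ ∧
    ∀ x y : F.V, F.lt x y ↔ G.lt (φ x) (φ y)

/-- The ordering of `G` is the restriction of the ordering of `H`. -/
def OrderRestricts (G H : OrderedSteinerSystem α r t) : Prop :=
  ∀ x ∈ G.V, ∀ y ∈ G.V, G.lt x y ↔ H.lt x y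

theorem iso_equivalence :
    Equivalence (Iso : OrderedSteinerSystem α r t → OrderedSteinerSystem α r t → Prop) where
  refl F := ⟨_, F.toSteinerSystem.isIsomorphism_refl, fun _ _ => Iff.rfl⟩
  symm := fun ⟨_, h, k⟩ => ⟨_, h.symm, fun x y => by rw [k]; simp⟩
  trans := fun ⟨_, h, k⟩ ⟨_, h', k'⟩ => ⟨_, h.trans h', fun x y => by rw [k, k']; rfl⟩

theorem OrderRestricts.trans {A B C : OrderedSteinerSystem α r t} (hV : A.V ⊆ B.V)
    (h : A.OrderRestricts B) (h' : B.OrderRestricts C) : A.OrderRestricts C :=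
  fun x hx y hy => (h x hx y hy).trans (h' x (hV hx) y (hV hy))

end OrderedSteinerSystem

/-- Whether the objects of a class of Steiner systems carry an ordering of the vertices. -/
inductive VertexOrdering where
  | unordered
  | ordered

/-- Whether subobjects are induced subsystems (weak) or strongly induced subsystems (strong). -/
inductive SubobjectType where
  | weak
  | strong

/-- The four classes of Steiner `(r, t)`-systems, with vertices in `α`. -/
def steinerClass (α : Type u) [DecidableEq α] (r t : ℕ) :
    VertexOrdering → SubobjectType → ObjectClass.{u}
  | .unordered, .weak =>
    { Obj := SteinerSystem α r t
      Iso := SteinerSystem.Iso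
      iso_equiv := SteinerSystem.iso_equivalence
      Sub := SteinerSystem.Induced
      sub_trans := SteinerSystem.Induced.trans }
  | .unordered, .strong =>
    { Obj := SteinerSystem α r t
      Iso := SteinerSystem.Iso
      iso_equiv := SteinerSystem.iso_equivalence
      Sub := SteinerSystem.StronglyInduced
      sub_trans := SteinerSystem.StronglyInduced.trans }
  | .ordered, .weak =>
    { Obj := OrderedSteinerSystem α r t
      Iso := OrderedSteinerSystem.Iso
      iso_equiv := OrderedSteinerSystem.iso_equivalence
      Sub := fun G H => G.toSteinerSystem.Induced H.toSteinerSystem ∧ G.OrderRestricts H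
      sub_trans := fun h h' => ⟨h.1.trans h'.1, h.2.trans h.1.1 h'.2⟩ }
  | .ordered, .strong =>
    { Obj := OrderedSteinerSystem α r t
      Iso := OrderedSteinerSystem.Iso
      iso_equiv := OrderedSteinerSystem.iso_equivalence
      Sub := fun G H => G.toSteinerSystem.StronglyInduced H.toSteinerSystem ∧ G.OrderRestricts H
      sub_trans := fun h h' => ⟨h.1.trans h'.1, h.2.trans h.1.1.1 h'.2⟩ }

/-- The unordered Steiner system underlying an object of one of the four classes. -/
def underlyingSystem {α : Type u} [DecidableEq α] {r t : ℕ} :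
    {o : VertexOrdering} → {s : SubobjectType} → (steinerClass α r t o s).Obj → SteinerSystem α r t
  | .unordered, .weak => fun F => F
  | .unordered, .strong => fun F => F
  | .ordered, .weak => fun F => OrderedSteinerSystem.toSteinerSystem F
  | .ordered, .strong => fun F => OrderedSteinerSystem.toSteinerSystem F

/-! Sufficiency reduces to one Ramsey theorem, `Picture.exists_strong_ramsey`, about ordered systems
and strongly induced copies. If `t = r` or `F` is complete, every induced copy of `F` is strongly
induced; if `F` is homogeneous, every unordered copy can be re-enumerated increasingly. So this one
theorem serves all four classes.

It is proved by a partite construction. Start with disjoint copies of `G`, one over each `n`-subset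
of `Fin N`, where `N` is a Ramsey number. For each increasing `φ : Fin m → Fin N` in turn, enlarge
the picture so that some copy of the previous one has all its copies of `F` over `φ` in one colour.
In the end the colour of a copy depends only on its projection, and the finite Ramsey theorem
finishes.

The enlargement at `φ` is the partite lemma `Picture.exists_arrow_singleton`. Hales–Jewett, with the
copies of `F` over `φ` as letters, suggests taking the union of copies of the picture indexed by
combinatorial lines. This union need not be a Steiner system, because an edge may have `t` vertices
over `φ` without lying over an edge of `F`. The copies of `F` given by words are nevertheless
strongly induced in it (`wordEmb_strong`). So the union serves only as the base of a second partite
construction, running over all words; there the obstruction is absent and the Hales–Jewett union is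
Steiner (`Picture.exists_arrow_of_strong`). Every word then has a colour, and a monochromatic line
selects the required copy.

Necessity rests on the ordering property (`exists_ordering_property`), where `t ≥ 2` enters: a
suitable `G` contains a prescribed ordered system in every ordering of its vertices. If `σ` is not
an automorphism of `F`, prescribe a system with one copy of `F` placed increasingly and one placed
through `σ`; colour copies by whether their increasing enumeration carries the edge set of `F`. If a
`t`-set of `F` is uncovered and weak copies count, prescribe two induced copies in which that set is
covered by edges lying differently in the order; colour by whether the covering edge reaches above
the copy. -/

/-! ### Finite Ramsey theorems -/

/-- Finite Ramsey theorem for `m`-element sets. -/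
theorem exists_ramsey_number (m n : ℕ) (κ : Type) [Finite κ] :
    ∃ N : ℕ, ∀ S : Finset ℕ, N ≤ S.card → ∀ χ : Finset ℕ → κ,
      ∃ T ⊆ S, T.card = n ∧ ∃ a, ∀ A ⊆ T, A.card = m → χ A = a := by
  induction m generalizing n with
  | zero =>
    refine ⟨n, fun S hS χ => ?_⟩
    obtain ⟨T, hT, hn⟩ := Finset.exists_subset_card_eq hS
    refine ⟨T, hT, hn, χ ∅, fun A _ hA => ?_⟩
    rw [Finset.card_eq_zero.1 hA]
  | succ m ih =>
    -- Intermediate step: on a large subset the colour of an `(m+1)`-set depends only on its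
    -- minimum.
    have key : ∀ k : ℕ, ∃ N : ℕ, ∀ S : Finset ℕ, N ≤ S.card → ∀ χ : Finset ℕ → κ,
        ∃ T ⊆ S, T.card = k ∧ ∃ f : ℕ → κ, ∀ A ⊆ T, A.card = m + 1 →
          ∀ a ∈ A, (∀ b ∈ A, a ≤ b) → χ A = f a := by
      intro k
      induction k with
      | zero =>
        refine ⟨0, fun S _ χ => ⟨∅, by simp, rfl, fun _ => χ ∅, fun A hA hc => ?_⟩⟩
        rw [Finset.subset_empty.1 hA] at hc
        simp at hc
      | succ k ihk =>
        obtain ⟨N, hN⟩ := ihk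
        obtain ⟨M, hM⟩ := ih N
        refine ⟨M + 1, fun S hS χ => ?_⟩
        have hne : S.Nonempty := Finset.card_pos.1 (by omega)
        set x := S.min' hne with hx
        have hxS : x ∈ S := S.min'_mem hne
        have hcard : M ≤ (S.erase x).card := by
          rw [Finset.card_erase_of_mem hxS]
          omega
        -- The induction on `m` fixes the colour `c` of all sets with minimum `x` inside `T'`; the
        -- induction on `k` then shrinks `T'` to treat the other sets.
        obtain ⟨T', hT', hcT', c, hc⟩ := hM _ hcard (fun B => χ (insert x B))
        obtain ⟨T, hT, hcT, f, hf⟩ := hN T' hcT'.ge χ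
        have hxT' : x ∉ T' := fun h => (Finset.mem_erase.1 (hT' h)).1 rfl
        have hxT : x ∉ T := fun h => hxT' (hT h)
        have hlt : ∀ b ∈ T, x < b := fun b hb => by
          have hb' := Finset.mem_erase.1 (hT' (hT hb))
          exact lt_of_le_of_ne (S.min'_le b hb'.2) (Ne.symm hb'.1)
        refine ⟨insert x T, ?_, by rw [Finset.card_insert_of_notMem hxT, hcT],
          Function.update f x c, fun A hA hcA a ha hmin => ?_⟩
        · exact Finset.insert_subset hxS ((hT.trans hT').trans (Finset.erase_subset _ _))
        · by_cases hxA : x ∈ A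
          · have hax : a = x := by
              rcases Finset.mem_insert.1 (hA ha) with h | h
              · exact h
              · exact absurd (hmin x hxA) (not_le.2 (hlt a h))
            subst hax
            rw [Function.update_self, ← Finset.insert_erase hxA]
            refine hc _ (fun b hb => ?_) (by rw [Finset.card_erase_of_mem hxA, hcA]; rfl)
            obtain ⟨hb1, hb2⟩ := Finset.mem_erase.1 hb
            exact hT ((Finset.mem_insert.1 (hA hb2)).resolve_left hb1)
          · have hAT : A ⊆ T := fun b hb =>
              (Finset.mem_insert.1 (hA hb)).resolve_left (fun h => hxA (h ▸ hb))
            have hax : a ≠ x := fun h => hxA (h ▸ ha)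
            rw [Function.update_of_ne hax]
            exact hf A hAT hcA a ha hmin
    classical
    have := Fintype.ofFinite κ
    -- Pigeonhole: among this many minima more than `n` share the same colour.
    obtain ⟨N, hN⟩ := key (Fintype.card κ * n + 1)
    refine ⟨N, fun S hS χ => ?_⟩
    obtain ⟨T, hT, hcT, f, hf⟩ := hN S hS χ
    obtain ⟨a, -, ha⟩ := Finset.exists_lt_card_fiber_of_mul_lt_card_of_maps_to
      (s := T) (t := Finset.univ) (f := f) (n := n) (fun _ _ => Finset.mem_univ _)
      (by rw [hcT, Finset.card_univ]; omega)
    obtain ⟨T', hT', hcT'⟩ := Finset.exists_subset_card_eq ha.le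
    refine ⟨T', (hT'.trans (Finset.filter_subset _ _)).trans hT, hcT', a, fun A hA hcA => ?_⟩
    have hne : A.Nonempty := Finset.card_pos.1 (by omega)
    rw [hf A ((hA.trans hT').trans (Finset.filter_subset _ _)) hcA _ (A.min'_mem hne)
      (fun b hb => A.min'_le b hb)]
    exact (Finset.mem_filter.1 (hT' (hA (A.min'_mem hne)))).2

/-- Finite Ramsey theorem for increasing sequences. -/
theorem exists_ramsey_strictMono (m n : ℕ) (κ : Type) [Finite κ] :
    ∃ N : ℕ, ∀ χ : (Fin m → Fin N) → κ, ∃ ψ : Fin n → Fin N, StrictMono ψ ∧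
      ∃ a, ∀ η : Fin m → Fin n, StrictMono η → χ (ψ ∘ η) = a := by
  classical
  -- The bound `m ≤ N` supplies a sequence `φ₀` whose colour is the default on sets of the wrong
  -- shape.
  obtain ⟨N, hmN, hN⟩ : ∃ N, m ≤ N ∧ ∀ S : Finset ℕ, N ≤ S.card → ∀ χ : Finset ℕ → κ,
      ∃ T ⊆ S, T.card = n ∧ ∃ a, ∀ A ⊆ T, A.card = m → χ A = a := by
    obtain ⟨N, hN⟩ := exists_ramsey_number m n κ
    exact ⟨max N m, le_max_right _ _, fun S hS => hN S ((le_max_left _ _).trans hS)⟩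
  refine ⟨N, fun χ => ?_⟩
  have hsub : ∀ A : Finset ℕ, A ⊆ Finset.range N → ∀ k, (h : A.card = k) →
      ∃ φ : Fin k → Fin N, StrictMono φ ∧ ∀ x, ((φ x : Fin N) : ℕ) = A.orderEmbOfFin h x := by
    intro A hA k h
    refine ⟨fun x => ⟨A.orderEmbOfFin h x, Finset.mem_range.1 (hA (A.orderEmbOfFin_mem h x))⟩,
      fun x y hxy => ?_, fun _ => rfl⟩
    exact (A.orderEmbOfFin h).strictMono hxy
  obtain ⟨A₀, hA₀, hcA₀⟩ := Finset.exists_subset_card_eq (s := Finset.range N) (by simpa using hmN)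
  obtain ⟨φ₀, -, -⟩ := hsub A₀ hA₀ m hcA₀
  obtain ⟨T, hT, hcT, a, ha⟩ := hN (Finset.range N) (by simp) (fun A =>
    if h : A ⊆ Finset.range N ∧ A.card = m then χ (hsub A h.1 m h.2).choose else χ φ₀)
  obtain ⟨ψ, hψ, hψ'⟩ := hsub T hT n hcT
  refine ⟨ψ, hψ, a, fun η hη => ?_⟩
  have hmono : StrictMono (fun x => ((ψ (η x) : Fin N) : ℕ)) := fun x y h => hψ (hη h)
  set A : Finset ℕ := Finset.univ.image (fun x => ((ψ (η x) : Fin N) : ℕ)) with hA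
  have hAT : A ⊆ T := by
    intro y hy
    obtain ⟨x, -, rfl⟩ := Finset.mem_image.1 hy
    rw [hψ']
    exact T.orderEmbOfFin_mem hcT _
  have hcA : A.card = m := by
    rw [hA, Finset.card_image_of_injective _ hmono.injective, Finset.card_univ, Fintype.card_fin]
  have h := ha A hAT hcA
  rw [dif_pos ⟨hAT.trans hT, hcA⟩] at h
  rw [← h]
  congr 1
  funext x
  apply Fin.ext
  rw [(hsub A (hAT.trans hT) m hcA).choose_spec.2 x,
    ← Finset.orderEmbOfFin_unique hcA (f := fun x => ((ψ (η x) : Fin N) : ℕ))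
      (fun x => Finset.mem_image_of_mem _ (Finset.mem_univ x)) hmono]
  rfl

/-! ### Edge sets and strong embeddings -/

open Combinatorics

/-- `E` is the edge set of a Steiner `(r, t)`-system. -/
def IsSteinerEdges {V : Type*} (r t : ℕ) (E : Set (Finset V)) : Prop :=
  (∀ e ∈ E, e.card = r) ∧
    ∀ x : Finset V, x.card = t → ∀ e ∈ E, ∀ e' ∈ E, x ⊆ e → x ⊆ e' → e = e'

/-- `j` embeds the system with edges `E` as an induced subsystem of the one with edges `E'`. -/
def InducedEmb {V W : Type*} (E : Set (Finset V)) (E' : Set (Finset W)) (j : V ↪ W) : Prop :=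
  ∀ e : Finset V, e ∈ E ↔ e.map j ∈ E'

/-- `j` embeds the system with edges `E` as a strongly induced subsystem of the one with
edges `E'`. -/
def StrongEmb {V W : Type*} (t : ℕ) (E : Set (Finset V)) (E' : Set (Finset W)) (j : V ↪ W) :
    Prop :=
  (∀ e ∈ E, e.map j ∈ E') ∧
    ∀ d ∈ E', ∀ x : Finset V, x.card = t → x.map j ⊆ d → ∃ e ∈ E, e.map j = d

section basics

variable {V W X : Type*} {r t : ℕ} {E : Set (Finset V)} {E' : Set (Finset W)} {E'' : Set (Finset X)}

theorem exists_map_eq_of_subset (j : V ↪ W) (y : Finset W) (h : ∀ w ∈ y, ∃ v, j v = w) :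
    ∃ x : Finset V, x.map j = y := by
  classical
  refine ⟨y.preimage j j.injective.injOn, ?_⟩
  ext w
  simp only [Finset.mem_map, Finset.mem_preimage]
  constructor
  · rintro ⟨v, hv, rfl⟩
    exact hv
  · intro hw
    obtain ⟨v, rfl⟩ := h w hw
    exact ⟨v, hw, rfl⟩

/-- Since `t ≤ r`, an edge in the image contains a `t`-set, so the second clause of `StrongEmb`
already yields the reflection of edges. -/
theorem StrongEmb.induced {j : V ↪ W} (hE' : IsSteinerEdges r t E') (htr : t ≤ r)
    (h : StrongEmb t E E' j) : InducedEmb E E' j := by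
  refine fun e => ⟨h.1 e, fun he => ?_⟩
  have hc := hE'.1 _ he
  rw [Finset.card_map] at hc
  obtain ⟨x, hx, hxt⟩ := Finset.exists_subset_card_eq (s := e) (n := t) (by omega)
  obtain ⟨e', he', h'⟩ := h.2 _ he x hxt (Finset.map_subset_map.2 hx)
  rwa [← Finset.map_inj.1 h']

theorem StrongEmb.trans {j : V ↪ W} {k : W ↪ X} (h : StrongEmb t E E' j)
    (h' : StrongEmb t E' E'' k) : StrongEmb t E E'' (j.trans k) := by
  refine ⟨fun e he => ?_, fun d hd x hx hxd => ?_⟩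
  · rw [← Finset.map_map]
    exact h'.1 _ (h.1 _ he)
  · rw [← Finset.map_map] at hxd
    obtain ⟨d', hd', rfl⟩ := h'.2 d hd (x.map j) (by simpa using hx) hxd
    obtain ⟨e, he, rfl⟩ := h.2 d' hd' x hx (Finset.map_subset_map.1 hxd)
    exact ⟨e, he, (Finset.map_map _ _ _).symm⟩

theorem InducedEmb.trans {j : V ↪ W} {k : W ↪ X} (h : InducedEmb E E' j)
    (h' : InducedEmb E' E'' k) : InducedEmb E E'' (j.trans k) := by
  intro e
  rw [h, h', Finset.map_map]

/-- The edges on `W` corresponding to `E` under an equivalence. -/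
def pullbackEdges (E : Set (Finset V)) (o : W ≃ V) : Set (Finset W) :=
  {e | e.map o.toEmbedding ∈ E}

theorem isSteinerEdges_pullback (hE : IsSteinerEdges r t E) (o : W ≃ V) :
    IsSteinerEdges r t (pullbackEdges E o) := by
  refine ⟨fun e he => (Finset.card_map _).symm.trans (hE.1 _ he), ?_⟩
  intro x hx e he e' he' h h'
  exact Finset.map_inj.1 (hE.2 (x.map o.toEmbedding) ((Finset.card_map _).trans hx) _ he _ he'
    (Finset.map_subset_map.2 h) (Finset.map_subset_map.2 h'))

theorem strongEmb_pullback (o : W ≃ V) :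
    StrongEmb t E (pullbackEdges E o) o.symm.toEmbedding := by
  have h : ∀ e : Finset V, (e.map o.symm.toEmbedding).map o.toEmbedding = e := fun e => by
    ext
    simp
  have h' : ∀ e : Finset W, (e.map o.toEmbedding).map o.symm.toEmbedding = e := fun e => by
    ext
    simp
  refine ⟨fun e he => ?_, fun d hd x hx hxd => ⟨_, hd, h' d⟩⟩
  change _ ∈ E
  rwa [h]

/-- The edges of a disjoint union of copies indexed by `I`. -/
def copiesEdges (I : Type*) (E : Set (Finset V)) : Set (Finset (I × V)) :=
  {d | ∃ i, ∃ e ∈ E, e.map (Function.Embedding.sectR i V) = d}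

theorem isSteinerEdges_copies (I : Type*) (ht : 1 ≤ t) (hE : IsSteinerEdges r t E) :
    IsSteinerEdges r t (copiesEdges I E) := by
  refine ⟨?_, ?_⟩
  · rintro _ ⟨i, e, he, rfl⟩
    rw [Finset.card_map, hE.1 e he]
  · rintro y hy _ ⟨i, e, he, rfl⟩ _ ⟨i', e', he', rfl⟩ h h'
    obtain ⟨p, hp⟩ : y.Nonempty := Finset.card_pos.1 (by omega)
    obtain ⟨v, -, rfl⟩ := Finset.mem_map.1 (h hp)
    obtain ⟨v', -, hv'⟩ := Finset.mem_map.1 (h' hp)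
    obtain rfl : i' = i := (Prod.ext_iff.1 hv').1
    obtain ⟨x, rfl⟩ := exists_map_eq_of_subset (Function.Embedding.sectR i' V) y
      (fun w hw => (Finset.mem_map.1 (h hw)).imp fun _ => And.right)
    rw [Finset.card_map] at hy
    rw [hE.2 x hy e he e' he' (Finset.map_subset_map.1 h) (Finset.map_subset_map.1 h')]

theorem strongEmb_sectR {I : Type*} (ht : 1 ≤ t) (i : I) :
    StrongEmb t E (copiesEdges I E) (Function.Embedding.sectR i V) := by
  refine ⟨fun e he => ⟨i, e, he, rfl⟩, ?_⟩
  rintro _ ⟨i', e, he, rfl⟩ x hx hxe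
  obtain ⟨v, hv⟩ : x.Nonempty := Finset.card_pos.1 (by omega)
  obtain ⟨v', -, hv'⟩ := Finset.mem_map.1 (hxe (Finset.mem_map_of_mem _ hv))
  obtain rfl : i' = i := (Prod.ext_iff.1 hv').1
  exact ⟨e, he, rfl⟩

end basics

/-! ### Amalgamation along combinatorial lines -/

section HalesJewettAmalgam

variable {U V J ι : Type} {r t : ℕ}

/-- The `i`-th coordinate of the image of `v`, a vertex at position `x`, under the embedding
given by the line `l`. -/
def lineCoord (letter : J → U ↪ V) (l : Line J ι) (x : U) (v : V) (i : ι) : V :=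
  (l.idxFun i).elim v (fun k => letter k x)

/-- The embedding of `V` attached to a combinatorial line `l` over the alphabet `J`: vertices with
a position `x : U` are mapped into a power of `V`, all others to a private copy. -/
def lineFun (q : V → Option U) (letter : J → U ↪ V) (l : Line J ι) (v : V) :
    (U × (ι → V)) ⊕ (Line J ι × V) :=
  (q v).elim (Sum.inr (l, v)) (fun x => Sum.inl (x, lineCoord letter l x v))

variable {q : V → Option U} {letter : J → U ↪ V}

theorem lineFun_some (l : Line J ι) {v : V} {x : U} (h : q v = some x) :
    lineFun q letter l v = Sum.inl (x, lineCoord letter l x v) := by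
  simp [lineFun, h]

theorem lineFun_none (l : Line J ι) {v : V} (h : q v = none) :
    lineFun q letter l v = Sum.inr (l, v) := by
  simp [lineFun, h]

theorem lineCoord_none {l : Line J ι} {i : ι} (h : l.idxFun i = none) (x : U) (v : V) :
    lineCoord letter l x v i = v := by
  simp [lineCoord, h]

theorem lineFun_eq_inl {l : Line J ι} {v : V} {x : U} {f : ι → V}
    (h : lineFun q letter l v = Sum.inl (x, f)) : q v = some x ∧ lineCoord letter l x v = f := by
  cases hv : q v with
  | none => simp [lineFun_none l hv] at h
  | some y =>
    rw [lineFun_some l hv] at h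
    obtain ⟨rfl, rfl⟩ := Prod.ext_iff.1 (Sum.inl_injective h)
    exact ⟨rfl, rfl⟩

/-- A line has an active coordinate, where a vertex with a position is recorded as itself; the other
vertices are kept apart by the private copy. -/
theorem lineFun_injective (l : Line J ι) : Function.Injective (lineFun q letter l) := by
  intro v v' h
  cases hv' : q v' with
  | none =>
    rw [lineFun_none l hv'] at h
    cases hv : q v with
    | none =>
      rw [lineFun_none l hv] at h
      simpa using h
    | some x => simp [lineFun_some l hv] at h
  | some x =>
    rw [lineFun_some l hv'] at h
    obtain ⟨i, hi⟩ := l.proper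
    have := congrFun (lineFun_eq_inl h).2 i
    rwa [lineCoord_none hi, lineCoord_none hi] at this

/-- `lineFun` as an embedding. -/
def lineEmb (q : V → Option U) (letter : J → U ↪ V) (l : Line J ι) :
    V ↪ (U × (ι → V)) ⊕ (Line J ι × V) :=
  ⟨lineFun q letter l, lineFun_injective l⟩

/-- The copy of `U` in the power of `V` attached to a word over the alphabet `J`. -/
def wordEmb (letter : J → U ↪ V) (w : ι → J) : U ↪ (U × (ι → V)) ⊕ (Line J ι × V) :=
  ⟨fun x => Sum.inl (x, fun i => letter (w i) x), fun _ _ h =>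
    (Prod.ext_iff.1 (Sum.inl_injective h)).1⟩

/-- All edges of all copies of `V` attached to lines. -/
def amalgamEdges (ι : Type) (q : V → Option U) (letter : J → U ↪ V) (E : Set (Finset V)) :
    Set (Finset ((U × (ι → V)) ⊕ (Line J ι × V))) :=
  {d | ∃ l : Line J ι, ∃ e ∈ E, e.map (lineEmb q letter l) = d}

/-- `d` lies entirely over the positions in `e`. -/
def LiesOver (q : V → Option U) (d : Finset V) (e : Finset U) : Prop :=
  (∀ v ∈ d, ∃ b ∈ e, q v = some b) ∧ ∀ b ∈ e, ∃ v ∈ d, q v = some b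

theorem liesOver_map {k : U ↪ V} (hk : ∀ x, q (k x) = some x) (e : Finset U) :
    LiesOver q (e.map k) e := by
  refine ⟨fun v hv => ?_, fun b hb => ⟨k b, Finset.mem_map_of_mem _ hb, hk b⟩⟩
  obtain ⟨b, hb, rfl⟩ := Finset.mem_map.1 hv
  exact ⟨b, hb, hk b⟩

theorem eq_of_mem_map_letter {k : U ↪ V} (hk : ∀ x, q (k x) = some x) {e : Finset U} {v : V} {b : U}
    (hv : v ∈ e.map k) (hvb : q v = some b) : b ∈ e ∧ v = k b := by
  obtain ⟨b', hb', rfl⟩ := Finset.mem_map.1 hv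
  obtain rfl : b' = b := by simpa [hk] using hvb
  exact ⟨hb', rfl⟩

variable {EF : Set (Finset U)} {E : Set (Finset V)}

/-- The coordinates of the image of an edge over an edge of `EF` are edges themselves. -/
theorem exists_coordinate_edges (hs : ∀ k, StrongEmb t EF E (letter k)) (l : Line J ι) {d : Finset V} (hd : d ∈ E)
    {e : Finset U} (he : e ∈ EF) (hde : LiesOver q d e) :
    ∃ D : ι → Finset V, (∀ i, D i ∈ E) ∧ (∀ i, l.idxFun i = none → D i = d) ∧
      ∀ v ∈ d, ∀ b, q v = some b → ∀ i, lineCoord letter l b v i ∈ D i := by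
  refine ⟨fun i => (l.idxFun i).elim d (fun k => e.map (letter k)), fun i => ?_,
    fun i hi => by simp [hi], fun v hv b hvb i => ?_⟩
  · cases h : l.idxFun i with
    | none => simpa [h] using hd
    | some k => simpa [h] using (hs k).1 e he
  · obtain ⟨b', hb', hvb'⟩ := hde.1 v hv
    obtain rfl : b = b' := by simpa [hvb] using hvb'
    cases h : l.idxFun i with
    | none => simpa [lineCoord, h] using hv
    | some k => simpa [lineCoord, h] using hb'

theorem q_lineCoord (hq : ∀ k x, q (letter k x) = some x) (l : Line J ι) {v : V} {b : U}
    (hvb : q v = some b) (i : ι) : q (lineCoord letter l b v i) = some b := by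
  unfold lineCoord
  cases l.idxFun i with
  | none => exact hvb
  | some k => exact hq k b

/-- Word copies are strongly induced in the amalgam. -/
theorem wordEmb_strong (hr : ∀ e ∈ E, e.card = r) (hs : ∀ k, StrongEmb t EF E (letter k))
    (hq : ∀ k x, q (letter k x) = some x) (w : ι → J) (l : Line J ι) {d : Finset V} (hd : d ∈ E)
    {x : Finset U} (hx : x.card = t) (hxd : x.map (wordEmb letter w) ⊆ d.map (lineEmb q letter l)) :
    ∃ e ∈ EF, e.map (wordEmb letter w) = d.map (lineEmb q letter l) := by
  have hmem : ∀ a ∈ x, ∃ v ∈ d, q v = some a ∧ ∀ i, lineCoord letter l a v i = letter (w i) a := by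
    intro a ha
    obtain ⟨v, hv, hva⟩ := Finset.mem_map.1 (hxd (Finset.mem_map_of_mem _ ha))
    obtain ⟨h1, h2⟩ := lineFun_eq_inl hva
    exact ⟨v, hv, h1, fun i => congrFun h2 i⟩
  -- At an active coordinate the shared vertices belong to `d` itself, so strongness of the letter
  -- `w i₀` makes `d` a copy of an edge `e`.
  obtain ⟨i₀, hi₀⟩ := l.proper
  have hx₀ : x.map (letter (w i₀)) ⊆ d := by
    intro y hy
    obtain ⟨a, ha, rfl⟩ := Finset.mem_map.1 hy
    obtain ⟨v, hv, -, h⟩ := hmem a ha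
    rw [← h i₀, lineCoord_none hi₀]
    exact hv
  obtain ⟨e, he, hed⟩ := (hs (w i₀)).2 d hd x hx hx₀
  have hde : LiesOver q d e := hed ▸ liesOver_map (hq _) e
  obtain ⟨D, hDE, -, hD⟩ := exists_coordinate_edges hs l hd he hde
  refine ⟨e, he, (Finset.eq_of_subset_of_card_le (fun y hy => ?_) ?_).symm⟩
  · obtain ⟨v, hv, rfl⟩ := Finset.mem_map.1 hy
    obtain ⟨b, hb, hvb⟩ := hde.1 v hv
    have : lineEmb q letter l v = wordEmb letter w b := by
      refine (lineFun_some l hvb).trans (congrArg Sum.inl (Prod.ext rfl (funext fun i => ?_)))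
      -- The coordinate edge `D i` has `t` vertices in common with the letter `w i`, hence is a copy
      -- of an edge under that letter; its vertex over `b` can only be `letter (w i) b`.
      obtain ⟨e', -, he'⟩ := (hs (w i)).2 (D i) (hDE i) x hx (by
        intro y hy
        obtain ⟨a, ha, rfl⟩ := Finset.mem_map.1 hy
        obtain ⟨v', hv', hva, h⟩ := hmem a ha
        rw [← h i]
        exact hD v' hv' a hva i)
      have h := hD v hv b hvb i
      rw [← he'] at h
      exact (eq_of_mem_map_letter (hq _) h (q_lineCoord hq l hvb i)).2
    rw [this]
    exact Finset.mem_map_of_mem _ hb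
  · rw [Finset.card_map, Finset.card_map, hr d hd, ← hr _ ((hs (w i₀)).1 e he), Finset.card_map]

/-- Private copies of distinct lines are disjoint, so two line copies meet only over common
positions. -/
theorem lineFun_inr_of_eq {l l' : Line J ι} (hl : l ≠ l') {v v' : V}
    (h : lineFun q letter l v = lineFun q letter l' v') : ∃ b, q v = some b ∧ q v' = some b := by
  cases hv : q v with
  | none =>
    cases hv' : q v' with
    | none =>
      rw [lineFun_none l hv, lineFun_none l' hv'] at h
      exact absurd (Prod.ext_iff.1 (Sum.inr_injective h)).1 hl
    | some b' => simp [lineFun_none l hv, lineFun_some l' hv'] at h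
  | some b =>
    rw [lineFun_some l hv] at h
    exact ⟨b, rfl, (lineFun_eq_inl h.symm).1⟩

variable (hE : IsSteinerEdges r t E)
  (hinj : ∀ d ∈ E, ∀ v ∈ d, ∀ v' ∈ d, ∀ b, q v = some b → q v' = some b → v = v')
  (hs : ∀ k, StrongEmb t EF E (letter k)) (hq : ∀ k x, q (letter k x) = some x)
  (hover : ∀ d ∈ E, ∀ x ⊆ d, x.card = t → (∀ v ∈ x, ∃ b, q v = some b) →
    ∃ e ∈ EF, LiesOver q d e)

include hE hinj hs hq hover

/-- For distinct lines the `t` shared vertices all have positions, so by `hover` both edges lie over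
edges of `EF` and have coordinate edges `D i` and `D' i` in `E`. These share `t` vertices, so they
agree for each `i` by the Steiner property of `E`. An edge has at most one vertex over each
position, so agreement of the coordinate edges identifies the two images. -/
theorem amalgam_edges_eq (l l' : Line J ι) {d d' : Finset V} (hd : d ∈ E) (hd' : d' ∈ E)
    {y : Finset ((U × (ι → V)) ⊕ (Line J ι × V))} (hy : y.card = t)
    (h : y ⊆ d.map (lineEmb q letter l)) (h' : y ⊆ d'.map (lineEmb q letter l')) :
    d.map (lineEmb q letter l) = d'.map (lineEmb q letter l') := by
  obtain ⟨x, rfl⟩ := exists_map_eq_of_subset (lineEmb q letter l) y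
    (fun w hw => (Finset.mem_map.1 (h hw)).imp fun _ => And.right)
  have hxd : x ⊆ d := Finset.map_subset_map.1 h
  by_cases hl : l = l'
  · subst hl
    rw [Finset.card_map] at hy
    rw [hE.2 x hy d hd d' hd' hxd (Finset.map_subset_map.1 h')]
  obtain ⟨x', hx'⟩ := exists_map_eq_of_subset (lineEmb q letter l') _
    (fun w hw => (Finset.mem_map.1 (h' hw)).imp fun _ => And.right)
  rw [← hx'] at h'
  have hxd' : x' ⊆ d' := Finset.map_subset_map.1 h'
  have hcx' : x'.card = t := by rw [← hy, ← hx', Finset.card_map]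
  rw [Finset.card_map] at hy
  have hxx' : ∀ v ∈ x, ∃ v' ∈ x', lineFun q letter l' v' = lineFun q letter l v := by
    intro v hv
    have : lineEmb q letter l v ∈ x'.map (lineEmb q letter l') := by
      rw [hx']
      exact Finset.mem_map_of_mem _ hv
    exact Finset.mem_map.1 this
  have hx'x : ∀ v' ∈ x', ∃ v ∈ x, lineFun q letter l v = lineFun q letter l' v' := by
    intro v hv
    have : lineEmb q letter l' v ∈ x.map (lineEmb q letter l) := by
      rw [← hx']
      exact Finset.mem_map_of_mem _ hv
    exact Finset.mem_map.1 this
  obtain ⟨e, he, hde⟩ := hover d hd x hxd hy (fun v hv => by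
    obtain ⟨v', -, h⟩ := hxx' v hv
    obtain ⟨b, hb, -⟩ := lineFun_inr_of_eq hl h.symm
    exact ⟨b, hb⟩)
  obtain ⟨e', he', hde'⟩ := hover d' hd' x' hxd' hcx' (fun v hv => by
    obtain ⟨v', -, h⟩ := hx'x v hv
    obtain ⟨b, -, hb⟩ := lineFun_inr_of_eq hl h
    exact ⟨b, hb⟩)
  obtain ⟨D, hDE, -, hD⟩ := exists_coordinate_edges hs l hd he hde
  obtain ⟨D', hDE', hDn', hD'⟩ := exists_coordinate_edges hs l' hd' he' hde'
  have hDD' : ∀ i, D i = D' i := by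
    intro i
    classical
    have hb : ∀ v ∈ x, ∃ b, q v = some b := fun v hv => (hde.1 v (hxd hv)).imp fun _ => And.right
    -- The default `v` is never taken on `x`, where all vertices have positions. Coordinates keep
    -- positions, which makes `c` injective on `x`.
    let c : V → V := fun v => (q v).elim v (fun b => lineCoord letter l b v i)
    have hc : ∀ v b, q v = some b → c v = lineCoord letter l b v i := fun v b h => by simp [c, h]
    refine hE.2 (x.image c) ?_ _ (hDE i) _ (hDE' i) ?_ ?_
    · rw [Finset.card_image_of_injOn, hy]
      intro v hv v' hv' hvv'
      obtain ⟨b, hb1⟩ := hb v hv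
      obtain ⟨b', hb2⟩ := hb v' hv'
      simp only [hc v b hb1, hc v' b' hb2] at hvv'
      have h1 := q_lineCoord hq l hb1 i
      rw [hvv', q_lineCoord hq l hb2 i] at h1
      obtain rfl : b' = b := by simpa using h1
      exact hinj d hd v (hxd hv) v' (hxd hv') _ hb1 hb2
    · intro z hz
      obtain ⟨v, hv, rfl⟩ := Finset.mem_image.1 hz
      obtain ⟨b, hvb⟩ := hb v hv
      rw [hc v b hvb]
      exact hD v (hxd hv) b hvb i
    · intro z hz
      obtain ⟨v, hv, rfl⟩ := Finset.mem_image.1 hz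
      obtain ⟨b, hvb⟩ := hb v hv
      obtain ⟨v', hv', hvv'⟩ := hxx' v hv
      rw [lineFun_some l hvb] at hvv'
      obtain ⟨h1, h2⟩ := lineFun_eq_inl hvv'
      rw [hc v b hvb, ← h2]
      exact hD' v' (hxd' hv') b h1 i
  refine Finset.eq_of_subset_of_card_le (fun z hz => ?_) (by
    rw [Finset.card_map, Finset.card_map, hE.1 d hd, hE.1 d' hd'])
  obtain ⟨v, hv, rfl⟩ := Finset.mem_map.1 hz
  obtain ⟨b, hb, hvb⟩ := hde.1 v hv
  -- At an active coordinate of `l'` the coordinate edge is `d'` itself, so it provides the vertex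
  -- of `d'` with the same image as `v`.
  obtain ⟨i₀, hi₀⟩ := l'.proper
  have hv' : lineCoord letter l b v i₀ ∈ d' := by
    rw [← hDn' i₀ hi₀, ← hDD']
    exact hD v hv b hvb i₀
  have hvb' := q_lineCoord hq l hvb i₀
  refine Finset.mem_map.2 ⟨_, hv', ?_⟩
  refine (lineFun_some l' hvb').trans (Eq.trans ?_ (lineFun_some l hvb).symm)
  refine congrArg Sum.inl (Prod.ext rfl (funext fun i => ?_))
  exact hinj (D' i) (hDE' i) _ (hD' _ hv' b hvb' i) _ (hDD' i ▸ hD v hv b hvb i) b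
    (q_lineCoord hq l' hvb' i) (q_lineCoord hq l hvb i)

theorem isSteinerEdges_amalgam : IsSteinerEdges r t (amalgamEdges ι q letter E) := by
  refine ⟨?_, ?_⟩
  · rintro _ ⟨l, d, hd, rfl⟩
    rw [Finset.card_map, hE.1 d hd]
  · rintro y hy _ ⟨l, d, hd, rfl⟩ _ ⟨l', d', hd', rfl⟩ h h'
    exact amalgam_edges_eq hE hinj hs hq hover l l' hd hd' hy h h'

/-- At an active coordinate of `l` the coordinate edge of `d'` contains `y`; its image under `l`
then shares `t` vertices with the image of `d'` under `l'`, and `amalgam_edges_eq` identifies them.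
-/
theorem lineEmb_strong (l : Line J ι) :
    StrongEmb t E (amalgamEdges ι q letter E) (lineEmb q letter l) := by
  refine ⟨fun e he => ⟨l, e, he, rfl⟩, ?_⟩
  rintro _ ⟨l', d', hd', rfl⟩ y hy h
  by_cases hl : l = l'
  · subst hl
    exact ⟨d', hd', rfl⟩
  obtain ⟨x', hx'⟩ := exists_map_eq_of_subset (lineEmb q letter l') _
    (fun w hw => (Finset.mem_map.1 (h hw)).imp fun _ => And.right)
  have hxd' : x' ⊆ d' := Finset.map_subset_map.1 (hx' ▸ h)
  have hcx' : x'.card = t := by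
    rw [← Finset.card_map (lineEmb q letter l'), hx', Finset.card_map, hy]
  have hx'y : ∀ v' ∈ x', ∃ v ∈ y, lineFun q letter l v = lineFun q letter l' v' := by
    intro v hv
    have : lineEmb q letter l' v ∈ y.map (lineEmb q letter l) := by
      rw [← hx']
      exact Finset.mem_map_of_mem _ hv
    exact Finset.mem_map.1 this
  obtain ⟨e', he', hde'⟩ := hover d' hd' x' hxd' hcx' (fun v hv => by
    obtain ⟨v', -, h⟩ := hx'y v hv
    obtain ⟨b, -, hb⟩ := lineFun_inr_of_eq hl h
    exact ⟨b, hb⟩)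
  obtain ⟨D', hDE', -, hD'⟩ := exists_coordinate_edges hs l' hd' he' hde'
  obtain ⟨i₀, hi₀⟩ := l.proper
  refine ⟨D' i₀, hDE' i₀, amalgam_edges_eq hE hinj hs hq hover l l' (hDE' i₀) hd'
    ((Finset.card_map _).trans hy) (Finset.map_subset_map.2 fun v hv => ?_) h⟩
  obtain ⟨v', hv', hvv'⟩ := Finset.mem_map.1 (h (Finset.mem_map_of_mem _ hv))
  obtain ⟨b, hvb', hvb⟩ := lineFun_inr_of_eq (Ne.symm hl) hvv'
  have h2 := (lineFun_eq_inl (hvv'.trans (lineFun_some l hvb))).2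
  rw [← lineCoord_none hi₀ b v, ← h2]
  exact hD' v' hv' b hvb' i₀

end HalesJewettAmalgam

/-! ### Pictures and the partite construction -/

/-- A picture over `P`: a finite Steiner `(r, t)`-system with a projection to `P` that is
injective on every edge. -/
structure Picture (P : Type) (r t : ℕ) where
  V : Type
  finite : Finite V
  proj : V → P
  E : Set (Finset V)
  steiner : IsSteinerEdges r t E
  injOn : ∀ d ∈ E, Set.InjOn proj d

namespace Picture

variable {P U κ : Type} {r t : ℕ}

/-- `D.Arrow B EF L κ`: for every colouring of the maps `U → D.V` there is a strongly induced copy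
of `B` in `D` over `P` in which, for each `φ ∈ L`, all strongly induced copies of `EF` over `φ` have
the same colour. -/
def Arrow (D B : Picture P r t) (EF : Set (Finset U)) (L : Set (U → P)) (κ : Type) : Prop :=
  ∀ χ : (U → D.V) → κ, ∃ g : B.V ↪ D.V, StrongEmb t B.E D.E g ∧
    (∀ v, D.proj (g v) = B.proj v) ∧
    ∀ φ ∈ L, ∃ a, ∀ j : U ↪ B.V, StrongEmb t EF B.E j → (∀ x, B.proj (j x) = φ x) →
      χ (g ∘ j) = a

theorem arrow_empty (B : Picture P r t) (EF : Set (Finset U)) : B.Arrow B EF ∅ κ := by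
  refine fun χ => ⟨Function.Embedding.refl _, ⟨fun e he => by simpa using he, fun d hd x _ _ => ?_⟩,
    fun _ => rfl, fun φ hφ => hφ.elim⟩
  exact ⟨d, hd, by simp⟩

/-- Strong copies compose: what the copy of `Q` in `D` achieves over `φ` is inherited by every copy
of `B` inside it. -/
theorem Arrow.insert {D Q B : Picture P r t} {EF : Set (Finset U)} {φ : U → P} {L : Set (U → P)}
    (h : D.Arrow Q EF {φ} κ) (h' : Q.Arrow B EF L κ) : D.Arrow B EF (insert φ L) κ := by
  intro χ
  obtain ⟨g, hg, hgp, hgχ⟩ := h χ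
  obtain ⟨g', hg', hgp', hgχ'⟩ := h' (fun j => χ (g ∘ j))
  refine ⟨g'.trans g, hg'.trans hg, fun v => (hgp _).trans (hgp' v), fun ψ hψ => ?_⟩
  rcases hψ with rfl | hψ
  · obtain ⟨a, ha⟩ := hgχ ψ rfl
    exact ⟨a, fun j hj hjp => ha (j.trans g') (hj.trans hg') fun x => (hgp' _).trans (hjp x)⟩
  · obtain ⟨a, ha⟩ := hgχ' ψ hψ
    exact ⟨a, fun j hj hjp => ha j hj hjp⟩

/-- The partite construction: amalgamating over the positions in `L` one after the other. -/
theorem exists_arrow_of_step (Good : Picture P r t → Prop) (EF : Set (Finset U)) (L : Set (U → P))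
    (hL : L.Finite)
    (step : ∀ φ ∈ L, ∀ B, Good B → ∃ D, Good D ∧ D.Arrow B EF {φ} κ) (B : Picture P r t)
    (hB : Good B) : ∃ D, Good D ∧ D.Arrow B EF L κ := by
  induction L, hL using Set.Finite.induction_on with
  | empty => exact ⟨B, hB, B.arrow_empty EF⟩
  | insert _ _ ih =>
    obtain ⟨Q, hQ, hQB⟩ := ih fun φ hφ => step φ (Set.mem_insert_of_mem _ hφ)
    obtain ⟨D, hD, hDQ⟩ := step _ (Set.mem_insert _ _) Q hQ
    exact ⟨D, hD, hDQ.insert hQB⟩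

/-- The position in `U` of a vertex of a picture relative to a map `φ : U → P`. -/
noncomputable def position (B : Picture P r t) (φ : U → P) (v : B.V) : Option U :=
  open Classical in if h : ∃ x, φ x = B.proj v then some h.choose else none

theorem position_eq_some (B : Picture P r t) {φ : U → P} (hφ : Function.Injective φ) (v : B.V)
    (x : U) : B.position φ v = some x ↔ φ x = B.proj v := by
  unfold position
  split_ifs with h
  · refine ⟨fun hx => ?_, fun hx => ?_⟩
    · rw [← Option.some_injective _ hx, h.choose_spec]
    · rw [hφ (h.choose_spec.trans hx.symm)]
  · exact ⟨fun hx => by simp at hx, fun hx => (h ⟨x, hx⟩).elim⟩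

/-- The type of strongly induced copies of `EF` in `B` over `φ`. -/
def CopiesOver (B : Picture P r t) (EF : Set (Finset U)) (φ : U → P) : Type :=
  {j : U ↪ B.V // StrongEmb t EF B.E j ∧ ∀ x, B.proj (j x) = φ x}

/-- The embedding of `U` underlying a copy over `φ`. -/
def copyEmb (B : Picture P r t) (EF : Set (Finset U)) (φ : U → P) (j : B.CopiesOver EF φ) :
    U ↪ B.V := j.1

instance [Finite U] (B : Picture P r t) (EF : Set (Finset U)) (φ : U → P) :
    Finite (B.CopiesOver EF φ) := by
  have := B.finite
  exact inferInstanceAs (Finite {j : U ↪ B.V // StrongEmb t EF B.E j ∧ ∀ x, B.proj (j x) = φ x})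

instance finite_line {J ι : Type} [Finite J] [Finite ι] : Finite (Line J ι) :=
  Finite.of_injective (fun l : Line J ι => l.idxFun) fun l l' h => by
    cases l
    cases l'
    simpa using h

/-- The projection of the amalgam to `P`. -/
def amalgamProj (B : Picture P r t) (φ : U → P) (J ι : Type) :
    (U × (ι → B.V)) ⊕ (Line J ι × B.V) → P :=
  Sum.elim (fun p => φ p.1) (fun p => B.proj p.2)

theorem amalgamProj_lineFun (B : Picture P r t) {φ : U → P} (hφ : Function.Injective φ) {J ι : Type}
    (letter : J → U ↪ B.V) (l : Line J ι) (v : B.V) :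
    B.amalgamProj φ J ι (lineEmb (B.position φ) letter l v) = B.proj v := by
  change B.amalgamProj φ J ι (lineFun (B.position φ) letter l v) = B.proj v
  cases h : B.position φ v with
  | none =>
    rw [lineFun_none l h]
    rfl
  | some x =>
    rw [lineFun_some l h]
    exact (B.position_eq_some hφ v x).1 h

theorem injOn_amalgamProj (B : Picture P r t) {φ : U → P} (hφ : Function.Injective φ) {J ι : Type}
    (letter : J → U ↪ B.V) (l : Line J ι) {d : Finset B.V} (hd : d ∈ B.E) :
    Set.InjOn (B.amalgamProj φ J ι) (d.map (lineEmb (B.position φ) letter l)) := by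
  intro y hy y' hy' h
  obtain ⟨v, hv, rfl⟩ := Finset.mem_map.1 (Finset.mem_coe.1 hy)
  obtain ⟨v', hv', rfl⟩ := Finset.mem_map.1 (Finset.mem_coe.1 hy')
  rw [amalgamProj_lineFun B hφ, amalgamProj_lineFun B hφ] at h
  rw [B.injOn d hd hv hv' h]

/-- Substituting the letter `j` at the active coordinates turns the line into the word `l j`. This
ties the copies of `EF` over `φ` in a line copy to the points of the Hales–Jewett line. -/
theorem lineEmb_copyEmb (B : Picture P r t) (EF : Set (Finset U)) {φ : U → P}
    (hφ : Function.Injective φ) {ι : Type} (l : Line (B.CopiesOver EF φ) ι)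
    (j : B.CopiesOver EF φ) (x : U) :
    lineEmb (B.position φ) (B.copyEmb EF φ) l (j.1 x) = wordEmb (B.copyEmb EF φ) (l j) x := by
  refine (lineFun_some l ((B.position_eq_some hφ _ x).2 (j.2.2 x).symm)).trans ?_
  refine congrArg Sum.inl (Prod.ext rfl (funext fun i => ?_))
  simp only [lineCoord, Line.coe_apply]
  cases l.idxFun i <;> rfl

/-- One step of the partite construction at a position `φ` that is strongly induced with respect
to the family `S` of projections of edges. -/
theorem exists_arrow_of_strong [Finite U] [Finite κ] (ht : 1 ≤ t) (EF : Set (Finset U)) {φ : U → P}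
    (hφ : Function.Injective φ) (S : Set (Set P))
    (hS : ∀ s ∈ S, ∀ x : Finset U, x.card = t → φ '' x ⊆ s → ∃ e ∈ EF, φ '' (e : Set U) = s)
    (B : Picture P r t) (hB : ∀ d ∈ B.E, B.proj '' d ∈ S) :
    ∃ D : Picture P r t, (∀ d ∈ D.E, D.proj '' d ∈ S) ∧ D.Arrow B EF {φ} κ := by
  classical
  have := B.finite
  obtain ⟨ι, _, hι⟩ := Line.exists_mono_in_high_dimension (B.CopiesOver EF φ) κ
  have hpos := B.position_eq_some hφ
  have hs : ∀ k, StrongEmb t EF B.E (B.copyEmb EF φ k) := fun k => k.2.1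
  have hq : ∀ k x, B.position φ (B.copyEmb EF φ k x) = some x :=
    fun k x => (hpos _ x).2 (k.2.2 x).symm
  have hinj : ∀ d ∈ B.E, ∀ v ∈ d, ∀ v' ∈ d, ∀ b, B.position φ v = some b →
      B.position φ v' = some b → v = v' := fun d hd v hv v' hv' b h h' =>
    B.injOn d hd hv hv' (((hpos _ _).1 h).symm.trans ((hpos _ _).1 h'))
  have hover : ∀ d ∈ B.E, ∀ x ⊆ d, x.card = t → (∀ v ∈ x, ∃ b, B.position φ v = some b) →
      ∃ e ∈ EF, LiesOver (B.position φ) d e := by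
    intro d hd x hxd hx hxq
    obtain ⟨v₀, hv₀⟩ : x.Nonempty := Finset.card_pos.1 (by omega)
    have : Nonempty U := ⟨(hxq v₀ hv₀).choose⟩
    choose! b hb using hxq
    have hinjb : Set.InjOn b x := fun v hv v' hv' h =>
      hinj d hd v (hxd hv) v' (hxd hv') _ (hb v hv) (h ▸ hb v' hv')
    -- The positions of `x` form a `t`-set whose `φ`-image lies in the projection of `d`, so `hS`
    -- makes that projection the image of an edge of `EF`.
    obtain ⟨e, he, hes⟩ := hS _ (hB d hd) (x.image b) (by rw [Finset.card_image_of_injOn hinjb, hx])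
      (by
        rintro _ ⟨y, hy, rfl⟩
        obtain ⟨v, hv, rfl⟩ := Finset.mem_image.1 (Finset.mem_coe.1 hy)
        exact ⟨v, hxd hv, ((hpos _ _).1 (hb v hv)).symm⟩)
    refine ⟨e, he, fun v hv => ?_, fun c hc => ?_⟩
    · obtain ⟨c, hc, hcv⟩ := hes.symm.subset (Set.mem_image_of_mem B.proj (Finset.mem_coe.2 hv))
      exact ⟨c, hc, (hpos _ _).2 hcv⟩
    · obtain ⟨v, hv, hcv⟩ := hes.subset (Set.mem_image_of_mem φ (Finset.mem_coe.2 hc))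
      exact ⟨v, hv, (hpos _ _).2 hcv.symm⟩
  let D : Picture P r t :=
    { V := (U × (ι → B.V)) ⊕ (Line (B.CopiesOver EF φ) ι × B.V)
      finite := inferInstance
      proj := B.amalgamProj φ _ ι
      E := amalgamEdges ι (B.position φ) (B.copyEmb EF φ) B.E
      steiner := isSteinerEdges_amalgam B.steiner hinj hs hq hover
      injOn := by
        rintro _ ⟨l, d, hd, rfl⟩
        exact B.injOn_amalgamProj hφ _ l hd }
  refine ⟨D, ?_, fun χ => ?_⟩
  · rintro _ ⟨l, d, hd, rfl⟩
    convert hB d hd using 1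
    rw [Finset.coe_map, Set.image_image]
    exact Set.image_congr fun v _ => B.amalgamProj_lineFun hφ _ l v
  · obtain ⟨l, a, hl⟩ := hι (fun w => χ (wordEmb (B.copyEmb EF φ) w))
    refine ⟨lineEmb (B.position φ) (B.copyEmb EF φ) l,
      lineEmb_strong B.steiner hinj hs hq hover l, B.amalgamProj_lineFun hφ _ l, ?_⟩
    rintro _ rfl
    refine ⟨a, fun j hj hjp => ?_⟩
    rw [← hl ⟨j, hj, hjp⟩]
    congr 1
    funext x
    exact B.lineEmb_copyEmb EF hφ l ⟨j, hj, hjp⟩ x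

/-- The partite lemma: one step of the partite construction at an arbitrary position. -/
theorem exists_arrow_singleton [Finite U] [Finite κ] (ht : 1 ≤ t) (EF : Set (Finset U)) {φ : U → P}
    (hφ : Function.Injective φ) (B : Picture P r t) :
    ∃ D : Picture P r t, D.Arrow B EF {φ} κ := by
  classical
  have := B.finite
  obtain ⟨ι, _, hι⟩ := Line.exists_mono_in_high_dimension (B.CopiesOver EF φ) κ
  have hs : ∀ k, StrongEmb t EF B.E (B.copyEmb EF φ k) := fun k => k.2.1
  have hq : ∀ k x, B.position φ (B.copyEmb EF φ k x) = some x :=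
    fun k x => (B.position_eq_some hφ _ x).2 (k.2.2 x).symm
  -- The union of the line copies need not be Steiner, so it is only a base set; `S` consists of its
  -- edges, with respect to which all words are strong.
  let Q : Type := (U × (ι → B.V)) ⊕ (Line (B.CopiesOver EF φ) ι × B.V)
  let S : Set (Set Q) := {s | ∃ d ∈ amalgamEdges ι (B.position φ) (B.copyEmb EF φ) B.E,
    s = ((d : Finset Q) : Set Q)}
  -- Separating the line copies restores the Steiner property; the projection remembers how they
  -- overlapped.
  let B' : Picture Q r t :=
    { V := Line (B.CopiesOver EF φ) ι × B.V
      finite := inferInstance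
      proj := fun p => lineEmb (B.position φ) (B.copyEmb EF φ) p.1 p.2
      E := copiesEdges _ B.E
      steiner := isSteinerEdges_copies _ ht B.steiner
      injOn := by
        rintro _ ⟨l, d, hd, rfl⟩ y hy y' hy' h
        obtain ⟨v, hv, rfl⟩ := Finset.mem_map.1 (Finset.mem_coe.1 hy)
        obtain ⟨v', hv', rfl⟩ := Finset.mem_map.1 (Finset.mem_coe.1 hy')
        exact congrArg _ ((lineEmb (B.position φ) (B.copyEmb EF φ) l).injective h) }
  obtain ⟨D', hD', hD'B'⟩ := exists_arrow_of_step (κ := κ)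
    (fun A : Picture Q r t => ∀ d ∈ A.E, A.proj '' d ∈ S) EF
    (Set.range fun w : ι → B.CopiesOver EF φ => (wordEmb (B.copyEmb EF φ) w : U → Q))
    (Set.finite_range _) (by
      rintro _ ⟨w, rfl⟩ A hA
      refine exists_arrow_of_strong ht EF (wordEmb _ w).injective S ?_ A hA
      rintro _ ⟨_, ⟨l, d, hd, rfl⟩, rfl⟩ x hx hxd
      obtain ⟨e, he, hed⟩ := wordEmb_strong B.steiner.1 hs hq w l hd hx (by
        rw [← Finset.coe_subset, Finset.coe_map]
        exact hxd)
      refine ⟨e, he, ?_⟩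
      rw [← hed, Finset.coe_map]) B' (by
      rintro _ ⟨l, d, hd, rfl⟩
      refine ⟨_, ⟨l, d, hd, rfl⟩, ?_⟩
      rw [Finset.coe_map, Finset.coe_map, Set.image_image]
      rfl)
  let D : Picture P r t :=
    { V := D'.V
      finite := D'.finite
      proj := fun v => B.amalgamProj φ _ ι (D'.proj v)
      E := D'.E
      steiner := D'.steiner
      injOn := by
        intro d hd
        obtain ⟨_, ⟨l, d', hd', rfl⟩, h⟩ := hD' d hd
        have hmaps : Set.MapsTo D'.proj d (d'.map (lineEmb (B.position φ) (B.copyEmb EF φ) l)) :=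
          h ▸ Set.mapsTo_image _ _
        exact (B.injOn_amalgamProj hφ (B.copyEmb EF φ) l hd').comp (D'.injOn d hd) hmaps }
  refine ⟨D, fun χ => ?_⟩
  obtain ⟨g, hg, hgp, hgχ⟩ := hD'B' χ
  -- The copy of `B'` is monochromatic over each word; Hales–Jewett is applied to this colouring of
  -- words.
  choose a ha using fun w : ι → B.CopiesOver EF φ => hgχ _ ⟨w, rfl⟩
  obtain ⟨l, c, hl⟩ := hι a
  have hsec : StrongEmb t B.E B'.E (Function.Embedding.sectR l B.V) := strongEmb_sectR ht l
  refine ⟨(Function.Embedding.sectR l B.V).trans g, hsec.trans hg, fun v => ?_, ?_⟩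
  · change B.amalgamProj φ _ ι (D'.proj (g (l, v))) = B.proj v
    rw [hgp]
    exact B.amalgamProj_lineFun hφ _ l v
  · rintro _ rfl
    refine ⟨c, fun j hj hjp => ?_⟩
    rw [← hl ⟨j, hj, hjp⟩]
    exact ha _ (j.trans (Function.Embedding.sectR l B.V)) (hj.trans hsec)
      (fun x => B.lineEmb_copyEmb EF hφ l ⟨j, hj, hjp⟩ x)

/-- The disjoint union of copies of a system on `Fin n`, one over each `n`-element subset
of `Fin N`. -/
def seqPicture (ht : 1 ≤ t) (N : ℕ) {n : ℕ} {EG : Set (Finset (Fin n))}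
    (hG : IsSteinerEdges r t EG) : Picture (Fin N) r t where
  V := {ψ : Fin n → Fin N // StrictMono ψ} × Fin n
  finite := inferInstance
  proj p := p.1.1 p.2
  E := copiesEdges _ EG
  steiner := isSteinerEdges_copies _ ht hG
  injOn := by
    rintro _ ⟨ψ, d, hd, rfl⟩ y hy y' hy' h
    obtain ⟨v, hv, rfl⟩ := Finset.mem_map.1 (Finset.mem_coe.1 hy)
    obtain ⟨v', hv', rfl⟩ := Finset.mem_map.1 (Finset.mem_coe.1 hy')
    exact congrArg _ (ψ.2.injective h)

/-- Lexicographic order by projection, with ties broken arbitrarily. It makes a copy over an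
increasing sequence increasing. -/
theorem exists_enumeration_extending {V : Type} [Finite V] {N : ℕ} (π : V → Fin N) :
    ∃ (K : ℕ) (o : Fin K ≃ V), ∀ v v', π v < π v' → o.symm v < o.symm v' := by
  have := Fintype.ofFinite V
  let f : V → Fin N ×ₗ Fin (Fintype.card V) := fun v => toLex (π v, Fintype.equivFin V v)
  have hf : Function.Injective f := fun v v' h =>
    (Fintype.equivFin V).injective (Prod.ext_iff.1 (toLex_inj.1 h)).2
  let _ : LinearOrder V := LinearOrder.lift' f hf
  have hlt : ∀ v v' : V, π v < π v' → v < v' := fun v v' h =>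
    show f v < f v' from Prod.Lex.toLex_lt_toLex.2 (Or.inl h)
  let o : Fin (Fintype.card V) ≃o V := Fintype.orderIsoFinOfCardEq V rfl
  exact ⟨_, o.toEquiv, fun v v' h => o.symm.strictMono (hlt v v' h)⟩

/-- The Ramsey property of ordered Steiner systems with strongly induced subsystems. -/
theorem exists_strong_ramsey (ht : 1 ≤ t) (κ : Type) [Finite κ] [Nonempty κ] {m n : ℕ}
    (EF : Set (Finset (Fin m))) (EG : Set (Finset (Fin n))) (hG : IsSteinerEdges r t EG) :
    ∃ (K : ℕ) (EH : Set (Finset (Fin K))), IsSteinerEdges r t EH ∧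
      ∀ χ : (Fin m → Fin K) → κ, ∃ g : Fin n ↪ Fin K, StrictMono g ∧ StrongEmb t EG EH g ∧
        ∃ a, ∀ η : Fin m ↪ Fin n, StrictMono η → StrongEmb t EF EG η → χ (g ∘ η) = a := by
  classical
  obtain ⟨N, hN⟩ := exists_ramsey_strictMono m n κ
  obtain ⟨B, hB⟩ : ∃ B, B = seqPicture (r := r) ht N hG := ⟨_, rfl⟩
  obtain ⟨D, -, hD⟩ := exists_arrow_of_step (κ := κ) (fun _ => True) EF
    {φ : Fin m → Fin N | StrictMono φ} (Set.toFinite _)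
    (fun φ hφ A _ => (exists_arrow_singleton ht EF hφ.injective A).imp fun _ h => ⟨trivial, h⟩)
    B trivial
  have := D.finite
  obtain ⟨K, o, ho⟩ := exists_enumeration_extending D.proj
  have hs := strongEmb_pullback (t := t) (E := D.E) o
  refine ⟨K, pullbackEdges D.E o, isSteinerEdges_pullback D.steiner _,
    fun χ => ?_⟩
  obtain ⟨g, hg, hgp, hgχ⟩ := hD fun j => χ (fun x => o.symm (j x))
  -- The arbitrary colour at maps that are not increasing is harmless: `a` is only evaluated at `ψ ∘
  -- η` with both factors increasing.
  have hχ' : ∀ φ : Fin m → Fin N, ∃ a, StrictMono φ → ∀ j : Fin m ↪ B.V,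
      StrongEmb t EF B.E j → (∀ x, B.proj (j x) = φ x) → χ (fun x => o.symm (g (j x))) = a := by
    intro φ
    by_cases hφ : StrictMono φ
    · exact (hgχ φ hφ).imp fun a ha _ => ha
    · exact ⟨Classical.arbitrary κ, fun h => absurd h hφ⟩
  choose a ha using hχ'
  obtain ⟨ψ, hψ, c, hc⟩ := hN a
  obtain ⟨f, hf, hfp⟩ : ∃ f : Fin n ↪ B.V, StrongEmb t EG B.E f ∧ ∀ x, B.proj (f x) = ψ x := by
    subst hB
    exact ⟨Function.Embedding.sectR ⟨ψ, hψ⟩ (Fin n), strongEmb_sectR ht _, fun _ => rfl⟩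
  refine ⟨(f.trans g).trans o.symm.toEmbedding, fun x y hxy => ho _ _ ?_, (hf.trans hg).trans hs, c,
    fun η hη hηs => ?_⟩
  · change D.proj (g (f x)) < D.proj (g (f y))
    rw [hgp, hgp, hfp, hfp]
    exact hψ hxy
  · rw [← hc η hη]
    exact ha (ψ ∘ η) (hψ.comp hη) (η.trans f) (hηs.trans hf) (fun x => hfp _)

end Picture

/-! ### Test systems for necessity and the ordering property -/

section joins

variable {U V W : Type*} {r t : ℕ}

/-- The union of the images of two edge sets. -/
def joinEdges (E : Set (Finset U)) (E' : Set (Finset V)) (j : U ↪ W) (j' : V ↪ W) :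
    Set (Finset W) :=
  {d | (∃ e ∈ E, e.map j = d) ∨ ∃ e ∈ E', e.map j' = d}

theorem joinEdges_comm (E : Set (Finset U)) (E' : Set (Finset V)) (j : U ↪ W) (j' : V ↪ W) :
    joinEdges E E' j j' = joinEdges E' E j' j :=
  Set.ext fun _ => or_comm

theorem not_subset_of_disjoint {j : U ↪ W} {j' : V ↪ W} (hj : ∀ u v, j u ≠ j' v) (ht : 1 ≤ t)
    {y : Finset W} (hy : y.card = t) {e : Finset U} {e' : Finset V} (h : y ⊆ e.map j)
    (h' : y ⊆ e'.map j') : False := by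
  obtain ⟨w, hw⟩ : y.Nonempty := Finset.card_pos.1 (by omega)
  obtain ⟨u, -, hu⟩ := Finset.mem_map.1 (h hw)
  obtain ⟨v, -, hv⟩ := Finset.mem_map.1 (h' hw)
  exact hj u v (hu.trans hv.symm)

theorem eq_of_subset_map {E : Set (Finset U)} (hE : IsSteinerEdges r t E) {j : U ↪ W} {y : Finset W}
    (hy : y.card = t) {e e' : Finset U} (he : e ∈ E) (he' : e' ∈ E) (h : y ⊆ e.map j)
    (h' : y ⊆ e'.map j) : e = e' := by
  obtain ⟨x, rfl⟩ := exists_map_eq_of_subset j y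
    (fun w hw => (Finset.mem_map.1 (h hw)).imp fun _ => And.right)
  exact hE.2 x ((Finset.card_map _).symm.trans hy) e he e' he' (Finset.map_subset_map.1 h)
    (Finset.map_subset_map.1 h')

theorem isSteinerEdges_join {E : Set (Finset U)} {E' : Set (Finset V)} (hE : IsSteinerEdges r t E)
    (hE' : IsSteinerEdges r t E') (ht : 1 ≤ t) {j : U ↪ W} {j' : V ↪ W}
    (hj : ∀ u v, j u ≠ j' v) : IsSteinerEdges r t (joinEdges E E' j j') := by
  refine ⟨?_, ?_⟩
  · rintro _ (⟨e, he, rfl⟩ | ⟨e, he, rfl⟩)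
    · rw [Finset.card_map, hE.1 e he]
    · rw [Finset.card_map, hE'.1 e he]
  · rintro y hy _ (⟨e, he, rfl⟩ | ⟨e, he, rfl⟩) _ (⟨e', he', rfl⟩ | ⟨e', he', rfl⟩) h h'
    · rw [eq_of_subset_map hE hy he he' h h']
    · exact (not_subset_of_disjoint hj ht hy h h').elim
    · exact (not_subset_of_disjoint hj ht hy h' h).elim
    · rw [eq_of_subset_map hE' hy he he' h h']

theorem strongEmb_join_left {E : Set (Finset U)} {E' : Set (Finset V)} (ht : 1 ≤ t) {j : U ↪ W}
    {j' : V ↪ W} (hj : ∀ u v, j u ≠ j' v) : StrongEmb t E (joinEdges E E' j j') j := by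
  refine ⟨fun e he => Or.inl ⟨e, he, rfl⟩, ?_⟩
  rintro _ (⟨e, he, rfl⟩ | ⟨e, he, rfl⟩) x hx h
  · exact ⟨e, he, rfl⟩
  · exact (not_subset_of_disjoint hj ht ((Finset.card_map _).trans hx) subset_rfl h).elim

theorem strongEmb_join_right {E : Set (Finset U)} {E' : Set (Finset V)} (ht : 1 ≤ t) {j : U ↪ W}
    {j' : V ↪ W} (hj : ∀ u v, j u ≠ j' v) : StrongEmb t E' (joinEdges E E' j j') j' := by
  rw [joinEdges_comm]
  exact strongEmb_join_left ht fun u v => (hj v u).symm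

/-- The image of an edge set together with one further edge. -/
def addEdge [DecidableEq W] (E : Set (Finset U)) (j : U ↪ W) (x₀ : Finset U) (Y : Finset W) :
    Set (Finset W) :=
  insert (x₀.map j ∪ Y) {d | ∃ e ∈ E, e.map j = d}

/-- The new edge meets the image of `j` exactly in that of `x₀`, so an old edge sharing `t` vertices
with it would cover `x₀`. -/
theorem isSteinerEdges_addEdge [DecidableEq W] {E : Set (Finset U)} (hE : IsSteinerEdges r t E)
    {x₀ : Finset U} (hx₀ : x₀.card = t) (hE₀ : ∀ e ∈ E, ¬ x₀ ⊆ e) {j : U ↪ W} {Y : Finset W}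
    (hY : t + Y.card = r) (hj : ∀ u, j u ∉ Y) : IsSteinerEdges r t (addEdge E j x₀ Y) := by
  have key : ∀ y : Finset W, y.card = t → ∀ e ∈ E, y ⊆ e.map j → y ⊆ x₀.map j ∪ Y → False := by
    intro y hy e he h h'
    obtain ⟨x, rfl⟩ := exists_map_eq_of_subset j y
      (fun w hw => (Finset.mem_map.1 (h hw)).imp fun _ => And.right)
    have hx : x ⊆ x₀ := fun u hu => by
      rcases Finset.mem_union.1 (h' (Finset.mem_map_of_mem _ hu)) with h | h
      · simpa using h
      · exact (hj u h).elim
    rw [Finset.card_map] at hy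
    rw [Finset.eq_of_subset_of_card_le hx (by omega)] at h
    exact hE₀ e he (Finset.map_subset_map.1 h)
  refine ⟨?_, ?_⟩
  · rintro _ (rfl | ⟨e, he, rfl⟩)
    · rw [Finset.card_union_of_disjoint, Finset.card_map, hx₀, hY]
      rw [Finset.disjoint_left]
      intro w hw
      obtain ⟨u, -, rfl⟩ := Finset.mem_map.1 hw
      exact hj u
    · rw [Finset.card_map, hE.1 e he]
  · rintro y hy _ (rfl | ⟨e, he, rfl⟩) _ (rfl | ⟨e', he', rfl⟩) h h'
    · rfl
    · exact (key y hy e' he' h' h).elim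
    · exact (key y hy e he h h').elim
    · rw [eq_of_subset_map hE hy he he' h h']

/-- The new edge leaves the image. When `x₀` is an uncovered `t`-set the copy is not strong, which
is the freedom that weak subobjects leave. -/
theorem inducedEmb_addEdge [DecidableEq W] {E : Set (Finset U)} {x₀ : Finset U} {j : U ↪ W}
    {Y : Finset W} (hY : Y.Nonempty) (hj : ∀ u, j u ∉ Y) : InducedEmb E (addEdge E j x₀ Y) j := by
  refine fun e => ⟨fun he => Or.inr ⟨e, he, rfl⟩, ?_⟩
  rintro (h | ⟨e', he', h⟩)
  · obtain ⟨w, hw⟩ := hY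
    obtain ⟨u, -, rfl⟩ := Finset.mem_map.1 (h.symm ▸ Finset.mem_union_right _ hw)
    exact (hj u hw).elim
  · rwa [← Finset.map_inj.1 h]

/-- Every edge set and its image under a permutation embed strictly monotonically into one
system. -/
theorem exists_join_perm {m : ℕ} {E : Set (Finset (Fin m))} (hE : IsSteinerEdges r t E)
    (ht : 1 ≤ t) (σ : Equiv.Perm (Fin m)) :
    ∃ (n : ℕ) (A : Set (Finset (Fin n))), IsSteinerEdges r t A ∧ ∃ k k' : Fin m ↪ Fin n,
      StrictMono k ∧ StrongEmb t E A k ∧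
      StrictMono k' ∧ StrongEmb t E A (σ.toEmbedding.trans k') := by
  have hj : ∀ u v : Fin m, Fin.castAddEmb m u ≠ Fin.natAddEmb m v := fun u v h => by
    have := congrArg Fin.val h
    simp at this
    omega
  have hσ : IsSteinerEdges r t (pullbackEdges E σ.symm) := isSteinerEdges_pullback hE _
  refine ⟨m + m, joinEdges E (pullbackEdges E σ.symm) (Fin.castAddEmb m) (Fin.natAddEmb m),
    isSteinerEdges_join hE hσ ht hj, Fin.castAddEmb m, Fin.natAddEmb m, fun _ _ h => h,
    strongEmb_join_left ht hj, Fin.strictMono_natAdd m, ?_⟩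
  have h : StrongEmb t E (pullbackEdges E σ.symm) σ.toEmbedding := strongEmb_pullback σ.symm
  exact h.trans (strongEmb_join_right ht hj)

/-- If `x₀` is not covered in `E`, then there is a system with two copies of `E` in which the
edges covering `x₀` are placed differently with respect to the ordering. -/
theorem exists_join_cover {m : ℕ} {E : Set (Finset (Fin m))} (hE : IsSteinerEdges r t E)
    (ht : 1 ≤ t) (htr : t < r) {x₀ : Finset (Fin m)} (hx₀ : x₀.card = t)
    (hE₀ : ∀ e ∈ E, ¬ x₀ ⊆ e) :
    ∃ (n : ℕ) (A : Set (Finset (Fin n))), IsSteinerEdges r t A ∧ ∃ k k' : Fin m ↪ Fin n,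
      (StrictMono k ∧ InducedEmb E A k ∧ ∃ d ∈ A, x₀.map k ⊆ d ∧ ∃ v ∈ d, ∀ i, k i < v) ∧
      (StrictMono k' ∧ InducedEmb E A k' ∧ ∃ d ∈ A, x₀.map k' ⊆ d ∧ ∀ v ∈ d, ∃ i, v ≤ k' i) := by
  -- The `s + 1 = r - t` new vertices come after the copy in the first system and before it in the
  -- second.
  obtain ⟨s, hs⟩ : ∃ s, r = t + (s + 1) := ⟨r - t - 1, by omega⟩
  let c : Fin m ↪ Fin (m + (s + 1)) := Fin.castAddEmb (s + 1)
  let Y : Finset (Fin (m + (s + 1))) := Finset.univ.map (Fin.natAddEmb m)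
  let c' : Fin m ↪ Fin (s + 1 + m) := Fin.natAddEmb (s + 1)
  let Y' : Finset (Fin (s + 1 + m)) := Finset.univ.map (Fin.castAddEmb m)
  have hc : ∀ u, c u ∉ Y := fun u h => by
    obtain ⟨v, -, hv⟩ := Finset.mem_map.1 h
    have := congrArg Fin.val hv
    simp [c] at this
    omega
  have hc' : ∀ u, c' u ∉ Y' := fun u h => by
    obtain ⟨v, -, hv⟩ := Finset.mem_map.1 h
    have := congrArg Fin.val hv
    simp [c'] at this
    omega
  have hj : ∀ (u : Fin (m + (s + 1))) (v : Fin (s + 1 + m)),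
      Fin.castAddEmb (s + 1 + m) u ≠ Fin.natAddEmb (m + (s + 1)) v := fun u v h => by
    have := congrArg Fin.val h
    simp at this
    omega
  have hst := isSteinerEdges_addEdge hE hx₀ hE₀ (r := r) (Y := Y) (by simp [Y, hs]) hc
  have hst' := isSteinerEdges_addEdge hE hx₀ hE₀ (r := r) (Y := Y') (by simp [Y', hs]) hc'
  have hjoin := isSteinerEdges_join hst hst' ht hj
  refine ⟨_, _, hjoin, c.trans (Fin.castAddEmb _), c'.trans (Fin.natAddEmb _),
    ⟨fun _ _ h => h, ?_, ?_⟩, ⟨fun _ _ h => by simpa [c'] using h, ?_, ?_⟩⟩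
  · exact (inducedEmb_addEdge (by simp [Y]) hc).trans
      ((strongEmb_join_left ht hj).induced hjoin htr.le)
  · refine ⟨_, Or.inl ⟨_, Or.inl rfl, rfl⟩, ?_, Fin.castAddEmb _ (Fin.natAddEmb m 0), ?_, ?_⟩
    · rw [← Finset.map_map]
      exact Finset.map_subset_map.2 Finset.subset_union_left
    · exact Finset.mem_map_of_mem _ (Finset.mem_union_right _ (by simp [Y]))
    · intro i
      simp [c, Fin.lt_def]
  · exact (inducedEmb_addEdge (by simp [Y']) hc').trans
      ((strongEmb_join_right ht hj).induced hjoin htr.le)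
  · refine ⟨_, Or.inr ⟨_, Or.inl rfl, rfl⟩, ?_, ?_⟩
    · rw [← Finset.map_map]
      exact Finset.map_subset_map.2 Finset.subset_union_left
    · intro v hv
      obtain ⟨i₀, -⟩ : x₀.Nonempty := Finset.card_pos.1 (by omega)
      obtain ⟨w, hw, rfl⟩ := Finset.mem_map.1 hv
      rcases Finset.mem_union.1 hw with hw | hw
      · obtain ⟨i, -, rfl⟩ := Finset.mem_map.1 hw
        exact ⟨i, le_rfl⟩
      · obtain ⟨i, -, rfl⟩ := Finset.mem_map.1 hw
        refine ⟨i₀, ?_⟩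
        simp [c', Fin.le_def]
        omega

/-- The ordering property: every ordered system occurs as a strongly induced subsystem with respect
to any ordering of a suitable system. -/
theorem exists_ordering_property (ht : 2 ≤ t) {n : ℕ} {A : Set (Finset (Fin n))}
    (hA : IsSteinerEdges r t A) :
    ∃ (K : ℕ) (EG : Set (Finset (Fin K))), IsSteinerEdges r t EG ∧
      ∀ (L : ℕ) (ρ : Fin K ↪ Fin L), ∃ g : Fin n ↪ Fin K, StrongEmb t A EG g ∧
        StrictMono fun i => ρ (g i) := by
  classical
  -- Two copies of `A` on even positions, `τ` increasing in the lower half and `τ'` decreasing in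
  -- the upper half; the odd positions remain isolated.
  let τ : Fin n ↪ Fin (4 * n) := ⟨fun i => ⟨2 * i, by omega⟩, fun i j h => by
    have := congrArg Fin.val h
    simp only at this
    omega⟩
  let τ' : Fin n ↪ Fin (4 * n) := ⟨fun i => ⟨4 * n - 2 - 2 * i, by omega⟩, fun i j h => by
    have := congrArg Fin.val h
    simp only at this
    omega⟩
  have hτ : ∀ i, (τ i : ℕ) = 2 * i := fun _ => rfl
  have hτ' : ∀ i, (τ' i : ℕ) = 4 * n - 2 - 2 * i := fun _ => rfl
  have hj : ∀ u v, τ u ≠ τ' v := fun u v h => by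
    have := congrArg Fin.val h
    rw [hτ, hτ'] at this
    omega
  have ht1 : 1 ≤ t := by omega
  have hjoin := isSteinerEdges_join hA hA ht1 hj
  obtain ⟨K, EG, hEG, hK⟩ := Picture.exists_strong_ramsey ht1 Bool (m := 2) ∅ _ hjoin
  refine ⟨K, EG, hEG, fun L ρ => ?_⟩
  obtain ⟨g, -, hgs, a, ha⟩ := hK fun j => decide (ρ (j 0) < ρ (j 1))
  have heven : ∀ d ∈ joinEdges A A τ τ', ∀ w ∈ d, (w : ℕ) % 2 = 0 := by
    rintro _ (⟨e, -, rfl⟩ | ⟨e, -, rfl⟩) w hw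
    · obtain ⟨i, -, rfl⟩ := Finset.mem_map.1 hw
      rw [hτ]
      omega
    · obtain ⟨i, -, rfl⟩ := Finset.mem_map.1 hw
      rw [hτ']
      omega
  -- An isolated vertex makes the pair a strong copy of the edgeless pair even if `t = 2`, when
  -- pairs inside an edge are not controlled.
  have hpair : ∀ u v : Fin (4 * n), u < v → ((u : ℕ) % 2 = 1 ∨ (v : ℕ) % 2 = 1) →
      decide (ρ (g u) < ρ (g v)) = a := by
    intro u v huv hodd
    have hmono : StrictMono ![u, v] := by
      intro x y hxy
      fin_cases x <;> fin_cases y <;> simp_all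
    refine ha ⟨![u, v], hmono.injective⟩ hmono ⟨fun e he => he.elim, fun d hd x hx hxd => ?_⟩
    have hx2 : x = Finset.univ :=
      Finset.eq_univ_of_card _ (le_antisymm (Finset.card_le_univ _) (by simpa [hx] using ht))
    subst hx2
    have hu := heven d hd u (hxd (Finset.mem_map.2 ⟨0, Finset.mem_univ _, rfl⟩))
    have hv := heven d hd v (hxd (Finset.mem_map.2 ⟨1, Finset.mem_univ _, rfl⟩))
    omega
  cases a with
  | true =>
    refine ⟨τ.trans g, (strongEmb_join_left ht1 hj).trans hgs, fun i j hij => ?_⟩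
    have hij' : (i : ℕ) < j := hij
    -- The isolated vertex just after `τ i` lets `τ i` and `τ j` be compared through two controlled
    -- pairs.
    let w : Fin (4 * n) := ⟨2 * i + 1, by omega⟩
    have h1 := hpair (τ i) w (by rw [Fin.lt_def, hτ]; simp [w]) (Or.inr (by simp [w]))
    have h2 := hpair w (τ j) (by rw [Fin.lt_def, hτ]; simp [w]; omega) (Or.inl (by simp [w]))
    exact (of_decide_eq_true h1).trans (of_decide_eq_true h2)
  | false =>
    refine ⟨τ'.trans g, (strongEmb_join_right ht1 hj).trans hgs, fun i j hij => ?_⟩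
    have hij' : (i : ℕ) < j := hij
    have hjn := j.2
    let w : Fin (4 * n) := ⟨4 * n - 2 - 2 * j + 1, by omega⟩
    have h1 := hpair (τ' j) w (by rw [Fin.lt_def, hτ']; simp [w]) (Or.inr (by simp [w]; omega))
    have h2 := hpair w (τ' i) (by rw [Fin.lt_def, hτ']; simp [w]; omega)
      (Or.inl (by simp [w]; omega))
    have h3 : ∀ u v, u ≠ v → decide (ρ (g u) < ρ (g v)) = false → ρ (g v) < ρ (g u) :=
      fun u v huv h => lt_of_le_of_ne (not_lt.1 (of_decide_eq_false h))
        fun h' => huv ((g.trans ρ).injective h').symm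
    refine (h3 w (τ' i) (fun h => ?_) h2).trans (h3 (τ' j) w (fun h => ?_) h1)
    · have := congrArg Fin.val h
      rw [hτ'] at this
      simp only [w] at this
      omega
    · have := congrArg Fin.val h
      rw [hτ'] at this
      simp only [w] at this
      omega

end joins

/-! ### Translation to edge sets on `Fin m` -/

namespace SteinerSystem

variable {α : Type u} {r t m n : ℕ}

/-- The Steiner system with an enumerated vertex set. -/
def ofEmb (f : Fin m ↪ α) (E : Set (Finset (Fin m))) (hE : IsSteinerEdges r t E) :
    SteinerSystem α r t where
  V := Finset.univ.map f
  E := {d | ∃ e ∈ E, e.map f = d}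
  edge_subset := by
    rintro _ ⟨e, -, rfl⟩
    exact Finset.map_subset_map.2 (Finset.subset_univ _)
  edge_card := by
    rintro _ ⟨e, he, rfl⟩
    rw [Finset.card_map, hE.1 e he]
  steiner := by
    rintro y - hy _ ⟨e, he, rfl⟩ _ ⟨e', he', rfl⟩ h h'
    rw [eq_of_subset_map hE hy he he' h h']

theorem map_mem_ofEmb {f : Fin m ↪ α} {E : Set (Finset (Fin m))} {hE : IsSteinerEdges r t E}
    {e : Finset (Fin m)} : e.map f ∈ (ofEmb f E hE).E ↔ e ∈ E := by
  refine ⟨?_, fun he => ⟨e, he, rfl⟩⟩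
  rintro ⟨e', he', h⟩
  rwa [← Finset.map_inj.1 h]

theorem eq_ofEmb {A : SteinerSystem α r t} {f : Fin m ↪ α} {E : Set (Finset (Fin m))}
    (hE : IsSteinerEdges r t E) (hV : A.V = Finset.univ.map f)
    (h : ∀ e, e ∈ E ↔ e.map f ∈ A.E) : A = ofEmb f E hE := by
  have hAE : A.E = {d | ∃ e ∈ E, e.map f = d} := by
    ext d
    constructor
    · intro hd
      obtain ⟨e, rfl⟩ := exists_map_eq_of_subset f d fun w hw => by
        have := A.edge_subset d hd hw
        rw [hV] at this
        exact (Finset.mem_map.1 this).imp fun _ => And.right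
      exact ⟨e, (h e).2 hd, rfl⟩
    · rintro ⟨e, he, rfl⟩
      exact (h e).1 he
  cases A
  simp only at hV hAE
  subst hV hAE
  rfl

theorem exists_eq_ofEmb (A : SteinerSystem α r t) (f : Fin m ↪ α) (hV : A.V = Finset.univ.map f) :
    ∃ E hE, A = ofEmb f E hE := by
  refine ⟨{e | e.map f ∈ A.E}, ⟨fun e he => ?_, fun x hx e he e' he' h h' => ?_⟩,
    eq_ofEmb _ hV fun e => Iff.rfl⟩
  · exact (Finset.card_map f).symm.trans (A.edge_card _ he)
  · refine Finset.map_inj.1 (A.steiner (x.map f) ?_ ((Finset.card_map f).trans hx) _ he _ he'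
      (Finset.map_subset_map.2 h) (Finset.map_subset_map.2 h'))
    rw [hV]
    exact Finset.map_subset_map.2 (Finset.subset_univ _)

/-- The enumeration of the vertex set. -/
noncomputable def enum (f : Fin m ↪ α) (E : Set (Finset (Fin m))) (hE : IsSteinerEdges r t E) :
    Fin m ≃ (ofEmb f E hE).V :=
  Equiv.ofBijective (fun x => ⟨f x, Finset.mem_map_of_mem f (Finset.mem_univ x)⟩)
    ⟨fun x y h => f.injective (congrArg Subtype.val h), fun ⟨a, ha⟩ => by
      obtain ⟨x, -, rfl⟩ := Finset.mem_map.1 ha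
      exact ⟨x, rfl⟩⟩

theorem map_enum (f : Fin m ↪ α) (E : Set (Finset (Fin m))) (hE : IsSteinerEdges r t E)
    (e : Finset (Fin m)) :
    (e.map (enum f E hE).toEmbedding).map (Function.Embedding.subtype _) = e.map f := by
  rw [Finset.map_map]
  rfl

/-- The isomorphism is absorbed into the enumeration, so isomorphic systems share the index edge set
`E` and differ only in the embedding of `Fin m`. -/
theorem iso_ofEmb {A : SteinerSystem α r t} {f : Fin m ↪ α} {E : Set (Finset (Fin m))}
    {hE : IsSteinerEdges r t E} {φ : A.V ≃ (ofEmb f E hE).V} (hφ : A.IsIsomorphism _ φ) :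
    A = ofEmb (((enum f E hE).trans φ.symm).toEmbedding.trans (Function.Embedding.subtype _))
      E hE := by
  refine eq_ofEmb hE ?_ fun e => ?_
  · ext a
    simp only [Finset.mem_map, Finset.mem_univ, true_and]
    constructor
    · intro ha
      exact ⟨(enum f E hE).symm (φ ⟨a, ha⟩), by simp⟩
    · rintro ⟨x, rfl⟩
      exact (φ.symm (enum f E hE x)).2
  · rw [← map_mem_ofEmb (f := f) (hE := hE), ← map_enum f E hE, hφ.symm, Finset.map_map,
      Finset.map_map]
    rfl

theorem isIsomorphism_ofEmb (f f' : Fin m ↪ α) (E : Set (Finset (Fin m)))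
    (hE : IsSteinerEdges r t E) :
    (ofEmb f E hE).IsIsomorphism (ofEmb f' E hE) ((enum f E hE).symm.trans (enum f' E hE)) := by
  intro e
  obtain ⟨e, rfl⟩ : ∃ e' : Finset (Fin m), e'.map (enum f E hE).toEmbedding = e :=
    exists_map_eq_of_subset _ _ fun w _ => ⟨(enum f E hE).symm w, by simp⟩
  have : (e.map (enum f E hE).toEmbedding).map ((enum f E hE).symm.trans (enum f' E hE)).toEmbedding
      = e.map (enum f' E hE).toEmbedding := by
    rw [Finset.map_map]
    congr 1
    ext x
    simp
  rw [this, map_enum, map_enum, map_mem_ofEmb, map_mem_ofEmb]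

theorem induced_ofEmb {k : Fin m ↪ Fin n} {h : Fin n ↪ α} {E : Set (Finset (Fin m))}
    {E' : Set (Finset (Fin n))} {hE : IsSteinerEdges r t E} {hE' : IsSteinerEdges r t E'} :
    (ofEmb (k.trans h) E hE).Induced (ofEmb h E' hE') ↔ InducedEmb E E' k := by
  constructor
  · intro H e
    rw [← map_mem_ofEmb (f := k.trans h) (hE := hE), H.2, ← Finset.map_map, map_mem_ofEmb]
    refine and_iff_left ?_
    rw [Finset.map_map]
    exact Finset.map_subset_map.2 (Finset.subset_univ _)
  · intro H
    refine ⟨?_, fun e => ⟨?_, ?_⟩⟩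
    · change Finset.univ.map (k.trans h) ⊆ Finset.univ.map h
      rw [← Finset.map_map]
      exact Finset.map_subset_map.2 (Finset.subset_univ _)
    · rintro ⟨e, he, rfl⟩
      refine ⟨⟨_, (H e).1 he, Finset.map_map _ _ _⟩, Finset.map_subset_map.2 (Finset.subset_univ _)⟩
    · rintro ⟨⟨e, he, rfl⟩, hek⟩
      change e.map h ⊆ Finset.univ.map (k.trans h) at hek
      rw [← Finset.map_map] at hek
      obtain ⟨e, rfl⟩ := exists_map_eq_of_subset k e fun w hw =>
        (Finset.mem_map.1 (Finset.map_subset_map.1 hek hw)).imp fun _ => And.right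
      exact ⟨e, (H e).2 he, (Finset.map_map _ _ _).symm⟩

theorem stronglyInduced_ofEmb [DecidableEq α] (htr : t ≤ r) {k : Fin m ↪ Fin n} {h : Fin n ↪ α}
    {E : Set (Finset (Fin m))} {E' : Set (Finset (Fin n))} {hE : IsSteinerEdges r t E}
    {hE' : IsSteinerEdges r t E'} :
    (ofEmb (k.trans h) E hE).StronglyInduced (ofEmb h E' hE') ↔ StrongEmb t E E' k := by
  unfold StronglyInduced
  rw [induced_ofEmb]
  constructor
  · rintro ⟨H, H'⟩
    refine ⟨fun e => (H e).1, fun d hd x hx hxd => ?_⟩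
    by_contra hcon
    refine (H' (d.map h) (map_mem_ofEmb.2 hd) ?_).not_ge ?_
    · rintro ⟨e, he, hed⟩
      rw [← Finset.map_map] at hed
      exact hcon ⟨e, he, Finset.map_inj.1 hed⟩
    · refine ((Finset.card_map (k.trans h)).trans hx).ge.trans
        (Finset.card_le_card (Finset.subset_inter ?_ ?_))
      · rw [← Finset.map_map]
        exact Finset.map_subset_map.2 hxd
      · exact Finset.map_subset_map.2 (Finset.subset_univ _)
  · intro H
    refine ⟨H.induced hE' htr, ?_⟩
    rintro _ ⟨d, hd, rfl⟩ hnot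
    by_contra hcon
    obtain ⟨y, hy, hyt⟩ := Finset.exists_subset_card_eq (not_lt.1 hcon)
    obtain ⟨x, rfl⟩ := exists_map_eq_of_subset (k.trans h) y fun w hw =>
      (Finset.mem_map.1 (Finset.mem_inter.1 (hy hw)).2).imp fun _ => And.right
    have hxd := hy.trans Finset.inter_subset_left
    rw [← Finset.map_map] at hxd
    obtain ⟨e, he, rfl⟩ := H.2 d hd x (by simpa using hyt) (Finset.map_subset_map.1 hxd)
    exact hnot ⟨e, he, (Finset.map_map _ _ _).symm⟩

theorem isHomogeneous_ofEmb {f : Fin m ↪ α} {E : Set (Finset (Fin m))}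
    {hE : IsSteinerEdges r t E} :
    (ofEmb f E hE).IsHomogeneous ↔
      ∀ (σ : Equiv.Perm (Fin m)) (e : Finset (Fin m)), e ∈ E ↔ e.map σ.toEmbedding ∈ E := by
  constructor
  · intro H σ e
    have := H ((enum f E hE).permCongr σ) (e.map (enum f E hE).toEmbedding)
    rw [map_enum, map_mem_ofEmb] at this
    rw [this, ← map_mem_ofEmb (f := f) (hE := hE), ← map_enum f E hE]
    refine iff_of_eq (congrArg (· ∈ _) (congrArg _ ?_))
    rw [Finset.map_map, Finset.map_map]
    congr 1
    ext x
    simp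
  · intro H σ e
    obtain ⟨e, rfl⟩ : ∃ e' : Finset (Fin m), e'.map (enum f E hE).toEmbedding = e :=
      exists_map_eq_of_subset _ _ fun w _ => ⟨(enum f E hE).symm w, by simp⟩
    rw [map_enum, map_mem_ofEmb, H ((enum f E hE).symm.permCongr σ),
      ← map_mem_ofEmb (f := f) (hE := hE), ← map_enum f E hE]
    refine iff_of_eq (congrArg (· ∈ _) (congrArg _ ?_))
    rw [Finset.map_map, Finset.map_map]
    congr 1
    ext x
    simp

theorem isComplete_ofEmb {f : Fin m ↪ α} {E : Set (Finset (Fin m))} {hE : IsSteinerEdges r t E} :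
    (ofEmb f E hE).IsComplete ↔ ∀ x : Finset (Fin m), x.card = t → ∃ e ∈ E, x ⊆ e := by
  constructor
  · intro H x hx
    obtain ⟨_, ⟨e, he, rfl⟩, hxe⟩ := H (x.map f) (Finset.map_subset_map.2 (Finset.subset_univ _))
      ((Finset.card_map f).trans hx)
    exact ⟨e, he, Finset.map_subset_map.1 hxe⟩
  · intro H y hy hyt
    obtain ⟨x, rfl⟩ := exists_map_eq_of_subset f y fun w hw =>
      (Finset.mem_map.1 (hy hw)).imp fun _ => And.right
    obtain ⟨e, he, hxe⟩ := H x ((Finset.card_map f).symm.trans hyt)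
    exact ⟨e.map f, ⟨e, he, rfl⟩, Finset.map_subset_map.2 hxe⟩

theorem exists_enum (A : SteinerSystem α r t) :
    ∃ (m : ℕ) (f : Fin m ↪ α) (E : _) (hE : _), A = ofEmb f E hE := by
  refine ⟨_, A.V.equivFin.symm.toEmbedding.trans (Function.Embedding.subtype _),
    A.exists_eq_ofEmb _ ?_⟩
  ext a
  simp only [Finset.mem_map, Finset.mem_univ, true_and]
  constructor
  · intro ha
    exact ⟨A.V.equivFin ⟨a, ha⟩, by simp⟩
  · rintro ⟨x, rfl⟩
    exact (A.V.equivFin.symm x).2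

end SteinerSystem

namespace OrderedSteinerSystem

variable {α : Type u} {r t m n : ℕ}

/-- The ordered Steiner system whose vertices are enumerated in increasing order. -/
def ofEmb (f : Fin m ↪ α) (E : Set (Finset (Fin m))) (hE : IsSteinerEdges r t E) :
    OrderedSteinerSystem α r t where
  toSteinerSystem := SteinerSystem.ofEmb f E hE
  lt a b := ∃ x y, x < y ∧ f x = a ∧ f y = b
  lt_mem := by
    rintro _ _ ⟨x, y, -, rfl, rfl⟩
    exact ⟨Finset.mem_map_of_mem f (Finset.mem_univ x), Finset.mem_map_of_mem f (Finset.mem_univ y)⟩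
  lt_irrefl := by
    rintro _ ⟨x, y, h, rfl, h'⟩
    exact h.ne' (f.injective h')
  lt_trans := by
    rintro _ _ _ ⟨x, y, h, rfl, rfl⟩ ⟨y', z, h', hy, rfl⟩
    exact ⟨x, z, h.trans (f.injective hy ▸ h'), rfl, rfl⟩
  lt_total := by
    intro a ha b hb hab
    obtain ⟨x, -, rfl⟩ := Finset.mem_map.1 ha
    obtain ⟨y, -, rfl⟩ := Finset.mem_map.1 hb
    rcases lt_trichotomy x y with h | h | h
    · exact Or.inl ⟨x, y, h, rfl, rfl⟩
    · exact absurd (congrArg f h) hab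
    · exact Or.inr ⟨y, x, h, rfl, rfl⟩

theorem ofEmb_lt {f : Fin m ↪ α} {E : Set (Finset (Fin m))} {hE : IsSteinerEdges r t E}
    {x y : Fin m} : (ofEmb f E hE).lt (f x) (f y) ↔ x < y := by
  refine ⟨?_, fun h => ⟨x, y, h, rfl, rfl⟩⟩
  rintro ⟨x', y', h, hx, hy⟩
  rwa [← f.injective hx, ← f.injective hy]

theorem eq_ofEmb {A : OrderedSteinerSystem α r t} {f : Fin m ↪ α} {E : Set (Finset (Fin m))}
    {hE : IsSteinerEdges r t E} (h : A.toSteinerSystem = SteinerSystem.ofEmb f E hE)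
    (hlt : ∀ x y, A.lt (f x) (f y) ↔ x < y) : A = ofEmb f E hE := by
  have hAlt : A.lt = (ofEmb f E hE).lt := by
    funext a b
    refine propext ⟨fun hab => ?_, ?_⟩
    · obtain ⟨ha, hb⟩ := A.lt_mem a b hab
      rw [h] at ha hb
      obtain ⟨x, -, rfl⟩ := Finset.mem_map.1 ha
      obtain ⟨y, -, rfl⟩ := Finset.mem_map.1 hb
      exact ⟨x, y, (hlt x y).1 hab, rfl, rfl⟩
    · rintro ⟨x, y, hxy, rfl, rfl⟩
      exact (hlt x y).2 hxy
  cases A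
  simp only at h hAlt
  subst h hAlt
  rfl

theorem exists_enum (A : OrderedSteinerSystem α r t) :
    ∃ (m : ℕ) (f : Fin m ↪ α), A.V = Finset.univ.map f ∧ ∀ x y, A.lt (f x) (f y) ↔ x < y := by
  classical
  let _ : LinearOrder A.V :=
    { le := fun a b => a = b ∨ A.lt a b
      lt := fun a b => A.lt a b
      le_refl := fun _ => Or.inl rfl
      le_trans := by
        rintro a b c (rfl | h) (rfl | h')
        · exact Or.inl rfl
        · exact Or.inr h'
        · exact Or.inr h
        · exact Or.inr (A.lt_trans _ _ _ h h')
      le_antisymm := by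
        rintro a b (rfl | h) (h' | h')
        · rfl
        · rfl
        · exact h'.symm
        · exact (A.lt_irrefl _ (A.lt_trans _ _ _ h h')).elim
      lt_iff_le_not_ge := by
        intro a b
        refine ⟨fun h => ⟨Or.inr h, ?_⟩, ?_⟩
        · rintro (rfl | h')
          · exact A.lt_irrefl _ h
          · exact A.lt_irrefl _ (A.lt_trans _ _ _ h h')
        · rintro ⟨rfl | h, h'⟩
          · exact (h' (Or.inl rfl)).elim
          · exact h
      le_total := by
        intro a b
        by_cases hab : a = b
        · exact Or.inl (Or.inl hab)
        · exact (A.lt_total a a.2 b b.2 fun h => hab (Subtype.ext h)).imp Or.inr Or.inr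
      toDecidableLE := Classical.decRel _ }
  let o : Fin (Fintype.card A.V) ≃o A.V := Fintype.orderIsoFinOfCardEq A.V rfl
  refine ⟨_, o.toEquiv.toEmbedding.trans (Function.Embedding.subtype _), ?_, fun x y => ?_⟩
  · ext a
    simp only [Finset.mem_map, Finset.mem_univ, true_and]
    constructor
    · intro ha
      exact ⟨o.symm ⟨a, ha⟩, by simp⟩
    · rintro ⟨x, rfl⟩
      exact (o x).2
  · exact o.lt_iff_lt (x := x) (y := y)

theorem orderRestricts_ofEmb {k : Fin m ↪ Fin n} {h : Fin n ↪ α} {E : Set (Finset (Fin m))}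
    {E' : Set (Finset (Fin n))} {hE : IsSteinerEdges r t E} {hE' : IsSteinerEdges r t E'} :
    (ofEmb (k.trans h) E hE).OrderRestricts (ofEmb h E' hE') ↔ StrictMono k := by
  have hmem : ∀ x, (k.trans h) x ∈ (ofEmb (k.trans h) E hE).V := fun x =>
    Finset.mem_map_of_mem _ (Finset.mem_univ x)
  constructor
  · intro H x y hxy
    exact ofEmb_lt.1 ((H _ (hmem x) _ (hmem y)).1 (ofEmb_lt.2 hxy))
  · intro H a ha b hb
    obtain ⟨x, -, rfl⟩ := Finset.mem_map.1 ha
    obtain ⟨y, -, rfl⟩ := Finset.mem_map.1 hb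
    rw [ofEmb_lt]
    exact H.lt_iff_lt.symm.trans ofEmb_lt.symm

theorem exists_eq_ofEmb (A : OrderedSteinerSystem α r t) :
    ∃ (m : ℕ) (f : Fin m ↪ α) (E : _) (hE : _), A = ofEmb f E hE := by
  obtain ⟨m, f, hV, hlt⟩ := A.exists_enum
  obtain ⟨E, hE, h⟩ := A.toSteinerSystem.exists_eq_ofEmb f hV
  exact ⟨m, f, E, hE, eq_ofEmb h hlt⟩

theorem iso_ofEmb {A : OrderedSteinerSystem α r t} {f : Fin m ↪ α} {E : Set (Finset (Fin m))}
    {hE : IsSteinerEdges r t E} (h : A.Iso (ofEmb f E hE)) : ∃ f', A = ofEmb f' E hE := by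
  obtain ⟨φ, hφ, hlt⟩ := h
  refine ⟨_, eq_ofEmb (SteinerSystem.iso_ofEmb hφ) fun x y => ?_⟩
  have hx := fun x => congrArg Subtype.val (φ.apply_symm_apply (SteinerSystem.enum f E hE x))
  exact (hlt (φ.symm (SteinerSystem.enum f E hE x)) (φ.symm (SteinerSystem.enum f E hE y))).trans
    ((iff_of_eq (congrArg₂ (ofEmb f E hE).lt (hx x) (hx y))).trans ofEmb_lt)

theorem iso_ofEmb_ofEmb (f f' : Fin m ↪ α) (E : Set (Finset (Fin m)))
    (hE : IsSteinerEdges r t E) : (ofEmb f E hE).Iso (ofEmb f' E hE) := by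
  refine ⟨_, SteinerSystem.isIsomorphism_ofEmb f f' E hE, fun x y => ?_⟩
  obtain ⟨x, rfl⟩ := (SteinerSystem.enum f E hE).surjective x
  obtain ⟨y, rfl⟩ := (SteinerSystem.enum f E hE).surjective y
  have hx := fun x => congrArg (fun y => (SteinerSystem.enum f' E hE y : α))
    ((SteinerSystem.enum f E hE).symm_apply_apply x)
  exact ofEmb_lt.trans
    (ofEmb_lt.symm.trans (iff_of_eq (congrArg₂ (ofEmb f' E hE).lt (hx x) (hx y)).symm))

end OrderedSteinerSystem

/-! ### Uniform treatment of the four classes -/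

section steinerClass

variable {α : Type u} [DecidableEq α] {r t m n : ℕ} {o : VertexOrdering} {s : SubobjectType}

/-- The embeddings corresponding to the two notions of subobjects. -/
def SubobjectEmb {V W : Type*} (s : SubobjectType) (t : ℕ) (E : Set (Finset V))
    (E' : Set (Finset W)) (j : V ↪ W) : Prop :=
  match s with
  | .weak => InducedEmb E E' j
  | .strong => StrongEmb t E E' j

theorem StrongEmb.subobjectEmb {V W : Type*} {E : Set (Finset V)} {E' : Set (Finset W)} {j : V ↪ W}
    (h : StrongEmb t E E' j) (hE' : IsSteinerEdges r t E') (htr : t ≤ r) :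
    SubobjectEmb s t E E' j := by
  cases s
  · exact h.induced hE' htr
  · exact h

theorem SubobjectEmb.induced {V W : Type*} {E : Set (Finset V)} {E' : Set (Finset W)} {j : V ↪ W}
    (h : SubobjectEmb s t E E' j) (hE' : IsSteinerEdges r t E') (htr : t ≤ r) :
    InducedEmb E E' j := by
  cases s
  · exact h
  · exact StrongEmb.induced hE' htr h

theorem SubobjectEmb.trans {V W X : Type*} {E : Set (Finset V)} {E' : Set (Finset W)}
    {E'' : Set (Finset X)} {j : V ↪ W} {k : W ↪ X} (h : SubobjectEmb s t E E' j)
    (h' : SubobjectEmb s t E' E'' k) : SubobjectEmb s t E E'' (j.trans k) := by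
  cases s
  · exact InducedEmb.trans h h'
  · exact StrongEmb.trans h h'

/-- The object of one of the four classes given by an enumeration of its vertices, which is
increasing in the ordered case. -/
def mkObj (o : VertexOrdering) (s : SubobjectType) (f : Fin m ↪ α) (E : Set (Finset (Fin m)))
    (hE : IsSteinerEdges r t E) : (steinerClass α r t o s).Obj :=
  match o, s with
  | .unordered, .weak => SteinerSystem.ofEmb f E hE
  | .unordered, .strong => SteinerSystem.ofEmb f E hE
  | .ordered, .weak => OrderedSteinerSystem.ofEmb f E hE
  | .ordered, .strong => OrderedSteinerSystem.ofEmb f E hE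

theorem underlyingSystem_mkObj (f : Fin m ↪ α) (E : Set (Finset (Fin m)))
    (hE : IsSteinerEdges r t E) :
    underlyingSystem (mkObj o s f E hE) = SteinerSystem.ofEmb f E hE := by
  cases o <;> cases s <;> rfl

theorem exists_eq_mkObj (A : (steinerClass α r t o s).Obj) :
    ∃ (m : ℕ) (f : Fin m ↪ α) (E : _) (hE : _), A = mkObj o s f E hE := by
  cases o <;> cases s
  · exact SteinerSystem.exists_enum A
  · exact SteinerSystem.exists_enum A
  · exact OrderedSteinerSystem.exists_eq_ofEmb A
  · exact OrderedSteinerSystem.exists_eq_ofEmb A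

theorem sub_mkObj (htr : t ≤ r) {k : Fin m ↪ Fin n} {h : Fin n ↪ α} {E : Set (Finset (Fin m))}
    {E' : Set (Finset (Fin n))} {hE : IsSteinerEdges r t E} {hE' : IsSteinerEdges r t E'} :
    (steinerClass α r t o s).Sub (mkObj o s (k.trans h) E hE) (mkObj o s h E' hE') ↔
      (o = .ordered → StrictMono k) ∧ SubobjectEmb s t E E' k := by
  cases o <;> cases s
  · exact (SteinerSystem.induced_ofEmb (hE := hE) (hE' := hE')).trans (by simp [SubobjectEmb])
  · exact (SteinerSystem.stronglyInduced_ofEmb htr (hE := hE) (hE' := hE')).trans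
      (by simp [SubobjectEmb])
  · exact (and_congr (SteinerSystem.induced_ofEmb (hE := hE) (hE' := hE'))
      OrderedSteinerSystem.orderRestricts_ofEmb).trans (by simp [SubobjectEmb, and_comm])
  · exact (and_congr (SteinerSystem.stronglyInduced_ofEmb htr (hE := hE) (hE' := hE'))
      OrderedSteinerSystem.orderRestricts_ofEmb).trans (by simp [SubobjectEmb, and_comm])

theorem iso_mkObj {A : (steinerClass α r t o s).Obj} {f : Fin m ↪ α} {E : Set (Finset (Fin m))}
    {hE : IsSteinerEdges r t E} :
    (steinerClass α r t o s).Iso A (mkObj o s f E hE) ↔ ∃ f', A = mkObj o s f' E hE := by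
  constructor
  · intro h
    cases o <;> cases s
    · obtain ⟨φ, hφ⟩ := h
      exact ⟨_, SteinerSystem.iso_ofEmb (hE := hE) hφ⟩
    · obtain ⟨φ, hφ⟩ := h
      exact ⟨_, SteinerSystem.iso_ofEmb (hE := hE) hφ⟩
    · exact OrderedSteinerSystem.iso_ofEmb h
    · exact OrderedSteinerSystem.iso_ofEmb h
  · rintro ⟨f', rfl⟩
    cases o <;> cases s
    · exact ⟨_, SteinerSystem.isIsomorphism_ofEmb f' f E hE⟩
    · exact ⟨_, SteinerSystem.isIsomorphism_ofEmb f' f E hE⟩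
    · exact OrderedSteinerSystem.iso_ofEmb_ofEmb f' f E hE
    · exact OrderedSteinerSystem.iso_ofEmb_ofEmb f' f E hE

theorem underlyingSystem_V_subset {A B : (steinerClass α r t o s).Obj}
    (h : (steinerClass α r t o s).Sub A B) : (underlyingSystem A).V ⊆ (underlyingSystem B).V := by
  cases o <;> cases s
  · exact And.left h
  · exact And.left (And.left h)
  · exact And.left (And.left h)
  · exact And.left (And.left (And.left h))

/-- The copies of `F` in `H` are given by embeddings of the index sets. -/
theorem mem_copies_mkObj (htr : t ≤ r) {A : (steinerClass α r t o s).Obj} {f : Fin m ↪ α}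
    {h : Fin n ↪ α} {E : Set (Finset (Fin m))} {E' : Set (Finset (Fin n))}
    {hE : IsSteinerEdges r t E} {hE' : IsSteinerEdges r t E'} :
    A ∈ (steinerClass α r t o s).copies (mkObj o s h E' hE') (mkObj o s f E hE) ↔
      ∃ j : Fin m ↪ Fin n, ((o = .ordered → StrictMono j) ∧ SubobjectEmb s t E E' j) ∧
        A = mkObj o s (j.trans h) E hE := by
  constructor
  · rintro ⟨hsub, hiso⟩
    obtain ⟨f', rfl⟩ := iso_mkObj.1 hiso
    have hV := underlyingSystem_V_subset hsub
    rw [underlyingSystem_mkObj, underlyingSystem_mkObj] at hV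
    have hx : ∀ x, ∃ y, h y = f' x := fun x =>
      (Finset.mem_map.1 (hV (Finset.mem_map_of_mem f' (Finset.mem_univ x)))).imp fun _ => And.right
    choose k hk using hx
    have hk' : (⟨k, fun x y hxy => f'.injective (by rw [← hk, hxy, hk])⟩ : Fin m ↪ Fin n).trans h
        = f' := Function.Embedding.ext hk
    rw [← hk'] at hsub ⊢
    exact ⟨_, (sub_mkObj htr).1 hsub, rfl⟩
  · rintro ⟨j, hj, rfl⟩
    exact ⟨(sub_mkObj htr).2 hj, iso_mkObj.2 ⟨_, rfl⟩⟩

/-- Only vertices and edges are compared, since an unordered object does not determine its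
enumeration. -/
theorem mkObj_injective {f f' : Fin m ↪ α} {E E' : Set (Finset (Fin m))}
    {hE : IsSteinerEdges r t E} {hE' : IsSteinerEdges r t E'}
    (h : mkObj o s f E hE = mkObj o s f' E' hE') :
    Finset.univ.map f = Finset.univ.map f' ∧
      ∀ d, (∃ e ∈ E, e.map f = d) ↔ ∃ e ∈ E', e.map f' = d := by
  have h' := congrArg underlyingSystem h
  rw [underlyingSystem_mkObj, underlyingSystem_mkObj] at h'
  exact ⟨congrArg SteinerSystem.V h', fun d => Set.ext_iff.1 (congrArg SteinerSystem.E h') d⟩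

/-- Makes the increasing embedding `j` that is quantified in the colourings below unique for each
copy. -/
theorem eq_of_strictMono_of_map_eq {j j' : Fin m ↪ Fin n} (hj : StrictMono j) (hj' : StrictMono j')
    (h : Finset.univ.map j = Finset.univ.map j') : j = j' := by
  have hc : (Finset.univ.map j).card = m := by simp
  refine Function.Embedding.ext fun x => ?_
  have h1 := Finset.orderEmbOfFin_unique hc (f := j)
    (fun x => Finset.mem_map_of_mem _ (Finset.mem_univ x)) hj
  have h2 := Finset.orderEmbOfFin_unique hc (f := j')
    (fun x => h ▸ Finset.mem_map_of_mem _ (Finset.mem_univ x)) hj'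
  rw [h1, h2]

theorem map_univ_perm_trans {β : Type*} (σ : Equiv.Perm (Fin m)) (k : Fin m ↪ β) :
    Finset.univ.map (σ.toEmbedding.trans k) = Finset.univ.map k := by
  rw [← Finset.map_map, Finset.map_univ_equiv]

theorem exists_embedding_fin (α : Type u) [Infinite α] (K : ℕ) : Nonempty (Fin K ↪ α) :=
  ⟨Fin.valEmbedding.trans (Infinite.natEmbedding α)⟩

/-! ### Sufficiency and necessity of the conditions -/

/-- The Ramsey property for all objects satisfying the two conditions. -/
theorem hasRamseyProperty_mkObj [Infinite α] (ht : 1 ≤ t) (htr : t ≤ r) {f : Fin m ↪ α}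
    {E : Set (Finset (Fin m))} {hE : IsSteinerEdges r t E}
    (hhom : o = .unordered → ∀ (σ : Equiv.Perm (Fin m)) (e : Finset (Fin m)),
      e ∈ E ↔ e.map σ.toEmbedding ∈ E)
    (hcom : s = .weak ∧ t < r → ∀ x : Finset (Fin m), x.card = t → ∃ e ∈ E, x ⊆ e) :
    (steinerClass α r t o s).HasRamseyProperty (mkObj o s f E hE) := by
  classical
  -- Weak copies are strong. If `F` is complete, the edge covering `x` inside `F` is `d` by the
  -- Steiner property; if `t = r`, then `d` is the image of `x`.
  have hstrong : ∀ {n : ℕ} {E' : Set (Finset (Fin n))}, IsSteinerEdges r t E' →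
      ∀ j : Fin m ↪ Fin n, SubobjectEmb s t E E' j → StrongEmb t E E' j := by
    intro n E' hE' j hj
    cases s with
    | strong => exact hj
    | weak =>
      refine ⟨fun e => (hj e).1, fun d hd x hx hxd => ?_⟩
      rcases htr.lt_or_eq with hlt | heq
      · obtain ⟨e, he, hxe⟩ := hcom ⟨rfl, hlt⟩ x hx
        exact ⟨e, he, hE'.2 (x.map j) ((Finset.card_map _).trans hx) _ ((hj e).1 he) d hd
          (Finset.map_subset_map.2 hxe) hxd⟩
      · have hxd' : x.map j = d := Finset.eq_of_subset_of_card_le hxd (by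
          rw [hE'.1 d hd, Finset.card_map, hx, heq])
        exact ⟨x, (hj x).2 (hxd' ▸ hd), hxd'⟩
  intro G c hc
  obtain ⟨n, g₀, EG, hG, rfl⟩ := exists_eq_mkObj G
  have : Nonempty (Fin c) := ⟨⟨0, hc⟩⟩
  obtain ⟨K, EH, hH, hK⟩ := Picture.exists_strong_ramsey ht (Fin c) E EG hG
  obtain ⟨h⟩ := exists_embedding_fin α K
  refine ⟨mkObj o s h EH hH, fun χ => ?_⟩
  have hcopy : ∀ j : Fin m ↪ Fin K, StrictMono j ∧ StrongEmb t E EH j →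
      mkObj o s (j.trans h) E hE ∈
        (steinerClass α r t o s).copies (mkObj o s h EH hH) (mkObj o s f E hE) :=
    fun j hj => (mem_copies_mkObj htr).2 ⟨j, ⟨fun _ => hj.1, hj.2.subobjectEmb hH htr⟩, rfl⟩
  obtain ⟨g, hg, hgs, a, ha⟩ := hK fun j =>
    if hj : ∃ j' : Fin m ↪ Fin K, ⇑j' = j ∧ StrictMono j' ∧ StrongEmb t E EH j' then
      χ ⟨_, hcopy hj.choose hj.choose_spec.2⟩ else Classical.arbitrary _
  refine ⟨mkObj o s (g.trans h) EG hG,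
    (mem_copies_mkObj htr).2 ⟨g, ⟨fun _ => hg, hgs.subobjectEmb hH htr⟩, rfl⟩, a, ?_⟩
  have key : ∀ η : Fin m ↪ Fin n, StrictMono η → StrongEmb t E EG η → ∀ A hA,
      A = mkObj o s (η.trans (g.trans h)) E hE → χ ⟨A, hA⟩ = a := by
    rintro η hη hηs _ hA rfl
    have hex : ∃ j' : Fin m ↪ Fin K, ⇑j' = g ∘ η ∧ StrictMono j' ∧ StrongEmb t E EH j' :=
      ⟨η.trans g, rfl, hg.comp hη, hηs.trans hgs⟩
    have h1 := ha η hη hηs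
    rw [dif_pos hex] at h1
    rw [← h1]
    refine congrArg χ (Subtype.ext ?_)
    have : hex.choose = η.trans g := DFunLike.coe_injective hex.choose_spec.1
    simp only [this]
    rfl
  intro F' hF'
  obtain ⟨j, ⟨hjo, hjs⟩, hF⟩ := (mem_copies_mkObj htr).1 hF'
  cases o with
  | ordered => exact key j (hjo rfl) (hstrong hG j hjs) _ _ hF
  | unordered =>
    -- Sorting gives an increasing enumeration of the copy; by homogeneity it describes the same
    -- system.
    obtain ⟨σ, hσ⟩ : ∃ σ : Equiv.Perm (Fin m), StrictMono fun x => j (σ x) := by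
      refine ⟨Tuple.sort j, (Tuple.monotone_sort j).strictMono_of_injective ?_⟩
      exact j.injective.comp (Tuple.sort j).injective
    have hσe := hhom rfl σ
    have hσE : StrongEmb t E E σ.toEmbedding := by
      refine ⟨fun e => (hσe e).1, fun d hd x _ _ => ⟨d.map σ.symm.toEmbedding, ?_, ?_⟩⟩
      · exact (hhom rfl σ.symm d).1 hd
      · ext
        simp
    refine key (σ.toEmbedding.trans j) hσ (hσE.trans (hstrong hG j hjs)) _ _ (hF.trans ?_)
    have hsys : SteinerSystem.ofEmb (j.trans (g.trans h)) E hE =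
        SteinerSystem.ofEmb ((σ.toEmbedding.trans j).trans (g.trans h)) E hE := by
      refine SteinerSystem.eq_ofEmb hE ?_ fun e => ?_
      · exact (map_univ_perm_trans σ (j.trans (g.trans h))).symm
      · change _ ↔ e.map (σ.toEmbedding.trans (j.trans (g.trans h))) ∈ _
        rw [← Finset.map_map, SteinerSystem.map_mem_ofEmb]
        exact hσe e
    cases s <;> exact hsys

/-- Condition (i) is necessary. -/
theorem perm_mem_of_hasRamseyProperty [Infinite α] (ht : 2 ≤ t) (htr : t ≤ r) {f : Fin m ↪ α}
    {E : Set (Finset (Fin m))} {hE : IsSteinerEdges r t E} (ho : o = .unordered)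
    (hR : (steinerClass α r t o s).HasRamseyProperty (mkObj o s f E hE))
    (σ : Equiv.Perm (Fin m)) (e : Finset (Fin m)) : e ∈ E ↔ e.map σ.toEmbedding ∈ E := by
  classical
  obtain ⟨n, A, hA, k, k', hk, hks, hk', hks'⟩ := exists_join_perm hE (by omega) σ
  obtain ⟨N, EG, hG, hN⟩ := exists_ordering_property ht hA
  obtain ⟨g₀⟩ := exists_embedding_fin α N
  obtain ⟨H, hH⟩ := hR (mkObj o s g₀ EG hG) 2 (by norm_num)
  obtain ⟨L, h, EH, hEH, rfl⟩ := exists_eq_mkObj H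
  -- Colour 1 means that the increasing enumeration of the copy, in the order given by `h`, carries
  -- `E`.
  obtain ⟨_, hG', i, hi⟩ := hH fun B =>
    if ∃ j : Fin m ↪ Fin L, StrictMono j ∧ B.1 = mkObj o s (j.trans h) E hE then 1 else 0
  obtain ⟨g, ⟨-, hgs⟩, rfl⟩ := (mem_copies_mkObj htr).1 hG'
  -- `g` pulls an arbitrary ordering back to `G`; the ordering property finds `A` in increasing
  -- position there.
  obtain ⟨l, hl, hgl⟩ := hN L g
  have hno : ∀ {p : Prop}, o = VertexOrdering.ordered → p := fun h => by simp [ho] at h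
  have h1 := hi (mkObj o s ((k.trans l).trans (g.trans h)) E hE) ((mem_copies_mkObj htr).2
    ⟨k.trans l, ⟨hno, (hks.trans hl).subobjectEmb hG htr⟩, rfl⟩)
  have h2 := hi (mkObj o s (((σ.toEmbedding.trans k').trans l).trans (g.trans h)) E hE)
    ((mem_copies_mkObj htr).2 ⟨(σ.toEmbedding.trans k').trans l,
      ⟨hno, (hks'.trans hl).subobjectEmb hG htr⟩, rfl⟩)
  rw [if_pos ⟨(k.trans l).trans g, hgl.comp hk, rfl⟩] at h1
  subst h1
  obtain ⟨j, hj, hjeq⟩ := of_not_not fun hcon => by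
    rw [if_neg hcon] at h2
    exact absurd h2 (by decide)
  -- The copy placed through `σ` also has colour 1, so its edges are described both by `E` and by
  -- the image of `E` under `σ`.
  obtain ⟨hV, hd⟩ := mkObj_injective hjeq
  have hjk : j = (k'.trans l).trans g := by
    refine eq_of_strictMono_of_map_eq hj (hgl.comp hk') ?_
    refine Finset.map_injective h ?_
    rw [Finset.map_map, ← hV, Finset.map_map]
    exact map_univ_perm_trans σ (((k'.trans l).trans g).trans h)
  subst hjk
  have hmap : ∀ e : Finset (Fin m), e.map (((σ.toEmbedding.trans k').trans l).trans (g.trans h)) =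
      (e.map σ.toEmbedding).map (((k'.trans l).trans g).trans h) := fun e => by
    rw [Finset.map_map]
    rfl
  simp only [hmap] at hd
  constructor
  · intro he
    obtain ⟨e', he', h'⟩ := (hd _).1 ⟨e, he, rfl⟩
    rwa [← Finset.map_injective _ h']
  · intro he
    obtain ⟨e', he', h'⟩ := (hd _).2 ⟨_, he, rfl⟩
    rwa [← Finset.map_injective _ (Finset.map_injective _ h')]

/-- Condition (ii) is necessary. -/
theorem exists_cover_of_hasRamseyProperty [Infinite α] (ht : 2 ≤ t) (htr : t < r) {f : Fin m ↪ α}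
    {E : Set (Finset (Fin m))} {hE : IsSteinerEdges r t E} (hs : s = .weak)
    (hR : (steinerClass α r t o s).HasRamseyProperty (mkObj o s f E hE))
    (x : Finset (Fin m)) (hx : x.card = t) : ∃ e ∈ E, x ⊆ e := by
  classical
  subst hs
  by_contra! hcon
  obtain ⟨n, A, hA, k, k', ⟨hk, hki, d, hd, hxd, v, hv, hkv⟩, hk', hki', d', hd', hxd', hkv'⟩ :=
    exists_join_cover hE (by omega) htr hx hcon
  obtain ⟨N, EG, hG, hN⟩ := exists_ordering_property ht hA
  obtain ⟨g₀⟩ := exists_embedding_fin α N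
  obtain ⟨H, hH⟩ := hR (mkObj o .weak g₀ EG hG) 2 (by norm_num)
  obtain ⟨L, h, EH, hEH, rfl⟩ := exists_eq_mkObj H
  -- Colour 1 means that an edge of `H` covering `x` in the copy has a vertex above the whole copy.
  obtain ⟨_, hG', i, hi⟩ := hH fun B =>
    if ∃ j : Fin m ↪ Fin L, StrictMono j ∧ B.1 = mkObj o .weak (j.trans h) E hE ∧
      ∃ d ∈ EH, x.map j ⊆ d ∧ ∃ v ∈ d, ∀ i, j i < v then 1 else 0
  obtain ⟨g, ⟨hgo, hgs⟩, rfl⟩ := (mem_copies_mkObj htr.le).1 hG'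
  obtain ⟨l, hl, hgl⟩ := hN L g
  have hli : InducedEmb A EG l := hl.induced hG htr.le
  -- In the ordered classes `g` is increasing, hence so is `l`, and both test copies are genuine
  -- ordered subobjects.
  have hmono : o = .ordered → StrictMono l := fun ho x y hxy => (hgo ho).lt_iff_lt.1 (hgl hxy)
  have hlg : ∀ b ∈ A, b.map (l.trans g) ∈ EH := fun b hb => ((hli.trans hgs) b).1 hb
  have h1 := hi (mkObj o .weak ((k.trans l).trans (g.trans h)) E hE) ((mem_copies_mkObj htr.le).2
    ⟨k.trans l, ⟨fun ho => (hmono ho).comp hk, hki.trans hli⟩, rfl⟩)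
  have h2 := hi (mkObj o .weak ((k'.trans l).trans (g.trans h)) E hE) ((mem_copies_mkObj htr.le).2
    ⟨k'.trans l, ⟨fun ho => (hmono ho).comp hk', hki'.trans hli⟩, rfl⟩)
  rw [if_pos ⟨(k.trans l).trans g, hgl.comp hk, rfl, d.map (l.trans g), hlg d hd, by
    change x.map (k.trans (l.trans g)) ⊆ _
    rw [← Finset.map_map]
    exact Finset.map_subset_map.2 hxd, g (l v), Finset.mem_map_of_mem _ hv,
    fun i => hgl (hkv i)⟩] at h1
  subst h1
  obtain ⟨j, hj, hjeq, b, hb, hxb, w, hw, hjw⟩ := of_not_not fun hcon => by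
    rw [if_neg hcon] at h2
    exact absurd h2 (by decide)
  have hjk : j = (k'.trans l).trans g := by
    refine eq_of_strictMono_of_map_eq hj (hgl.comp hk') (Finset.map_injective h ?_)
    rw [Finset.map_map, ← (mkObj_injective hjeq).1, Finset.map_map]
    rfl
  subst hjk
  -- The covering edge in `H` is unique, so the edge `b` witnessing colour 1 is the image of `d'`,
  -- which does not reach above the copy.
  have hbd : b = d'.map (l.trans g) := by
    refine hEH.2 _ ((Finset.card_map _).trans hx) _ hb _ (hlg d' hd') hxb ?_
    change x.map (k'.trans (l.trans g)) ⊆ _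
    rw [← Finset.map_map]
    exact Finset.map_subset_map.2 hxd'
  subst hbd
  obtain ⟨u, hu, rfl⟩ := Finset.mem_map.1 hw
  obtain ⟨i, hi'⟩ := hkv' u hu
  exact (hjw i).not_ge (hgl.monotone hi')

end steinerClass

/-- The infinite type `α` is the (arbitrary) supply of possible vertices. -/
theorem theorem1p11 {α : Type u} [DecidableEq α] [Infinite α] (r t : ℕ) (ht : 2 ≤ t) (htr : t ≤ r)
    (o : VertexOrdering) (s : SubobjectType) (F : (steinerClass α r t o s).Obj) :
    (steinerClass α r t o s).HasRamseyProperty F ↔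
      (o = VertexOrdering.unordered → (underlyingSystem F).IsHomogeneous) ∧
      (s = SubobjectType.weak ∧ t < r → (underlyingSystem F).IsComplete) := by
  obtain ⟨m, f, E, hE, rfl⟩ := exists_eq_mkObj F
  rw [underlyingSystem_mkObj, SteinerSystem.isHomogeneous_ofEmb, SteinerSystem.isComplete_ofEmb]
  constructor
  · intro hR
    exact ⟨fun ho => perm_mem_of_hasRamseyProperty ht htr ho hR,
      fun h => exists_cover_of_hasRamseyProperty ht h.2 h.1 hR⟩
  · rintro ⟨h1, h2⟩
    exact hasRamseyProperty_mkObj (by omega) htr h1 h2
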